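/- Let $k\ge 1$ and $\delta\in(0,1)$. Consider $k$ workers on the halfline $[0,\infty)$ with initial locations ${\bf x}=(x_{-k+1},\ldots,x_0)$, where $$0<x=x_{-k+1}\le x_{-k+2}\le\ldots\le x_0\le(2-\delta)x .$$ There is one dust particle at the origin, and all other dust particles are located at the points of a rate-1 Poisson process on $(a,\infty)$, where $x\le a\le x_0$ (in particular, $a=x$ and $a=x_0$ are allowed). Each worker has its own clock, which rings at the points of a rate-1 Poisson process on $(0,\infty)$; the clocks and the dust process are independent. Whenever the clock of a worker rings, this worker jumps instantaneously to the closest remaining dust particle (ties being resolved in favour of the particle nearer to the origin), removes it, and stays there until its clock rings again. Let $P_k({\bf x})=P_k({\bf x};a)$ be the probability that the dust particle at the origin is never removed. Then $$\lim_{x\to0}\frac{\log P_k({\bf x})}{\log^2 x}=-\frac{k}{2\log 2},$$ uniformly in all such ${\bf x}$ with given $x$ (that is, in the ratios $x_{-k+i}/x\in[1,2-\delta]$) and in $a\in[x,x_0]$. That is, for every $\varepsilon>0$ there is $\eta>0$, depending only on $k,\delta,\varepsilon$, such that whenever $0<x<\eta$, one has $P_k({\bf x})>0$ and $$\left|\frac{\log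 P_k({\bf x})}{\log^2 x}+\frac{k}{2\log 2}\right|<\varepsilon$$ for all ${\bf x}$ and $a$ as above. -/

import Mathlib

namespace GreedyCleaning

open MeasureTheory ProbabilityTheory

/-- A realisation of the randomness for `k` workers: the successive gaps between the points of the
Poisson dust process, and, for each worker `w` and each `n`, the waiting time between the `n`-th and
the `(n+1)`-st ring of the clock of `w`. -/
abbrev Env (k : ℕ) : Type := (ℕ → ℝ) × (Fin k × ℕ → ℝ)

/-- All gaps (of the dust process and of the `k` clocks) are independent exponential variables of
rate one, i.e. the dust process and the clocks are independent rate-one Poisson processes. -/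
noncomputable def envLaw (k : ℕ) : Measure (Env k) :=
  (Measure.infinitePi fun _ : ℕ => expMeasure 1).prod
    (Measure.infinitePi fun _ : Fin k × ℕ => expMeasure 1)

/-- Locations of the dust particles: particle `0` is at the origin, and particles `1, 2, …` are
the successive points of the Poisson process on `(a, ∞)` with the given gaps. -/
noncomputable def dust (a : ℝ) (gap : ℕ → ℝ) : ℕ → ℝ
  | 0 => 0
  | n + 1 => a + ∑ i ∈ Finset.range (n + 1), gap i

/-- The time of the `(n+1)`-st ring of the clock of worker `w`. -/
noncomputable def ringTime {k : ℕ} (wait : Fin k × ℕ → ℝ) (w : Fin k) (n : ℕ) : ℝ :=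
  ∑ i ∈ Finset.range (n + 1), wait (w, i)

/-- The state of the system between two successive rings. -/
structure State (k : ℕ) where
  /-- the current location of each worker -/
  pos : Fin k → ℝ
  /-- how many times the clock of each worker has already rung -/
  rings : Fin k → ℕ
  /-- the (labels of the) dust particles removed so far -/
  removed : Finset ℕ

/-- Particle `i` has not been removed, and no remaining particle is closer to the location `y`. -/
def IsClosest (d : ℕ → ℝ) (removed : Finset ℕ) (y : ℝ) (i : ℕ) : Prop :=
  i ∉ removed ∧ ∀ j, j ∉ removed → |d i - y| ≤ |d j - y|

open Classical in
/-- The closest remaining particle to `y`. Ties are broken in favour of the smallest label, i.e.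
of the particle nearest to the origin. (A closest particle exists whenever the locations of the
particles tend to infinity, which is almost surely the case.) -/
noncomputable def closest (d : ℕ → ℝ) (removed : Finset ℕ) (y : ℝ) : Option ℕ :=
  if h : ∃ i, IsClosest d removed y i then some (Nat.find h) else none

/-- The worker whose clock is the next to ring, given the numbers of past rings (`none` only if
there are no workers; the ring times of different workers are almost surely distinct). -/
noncomputable def nextWorker {k : ℕ} (wait : Fin k × ℕ → ℝ) (rings : Fin k → ℕ) :
    Option (Fin k) :=
  (List.finRange k).argmin fun w => ringTime wait w (rings w)

/-- When the clock of worker `w` rings, `w` jumps to the closest remaining particle and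
removes it. -/
noncomputable def ring {k : ℕ} (d : ℕ → ℝ) (s : State k) (w : Fin k) : State k :=
  match closest d s.removed (s.pos w) with
  | some i =>
    { pos := Function.update s.pos w (d i)
      rings := Function.update s.rings w (s.rings w + 1)
      removed := insert i s.removed }
  | none => { s with rings := Function.update s.rings w (s.rings w + 1) }

/-- The state after the first `n` rings (of all the clocks together, in the order of time), for
workers initially at the locations `p` and a Poisson dust process on `(a, ∞)`. -/
noncomputable def stateAfter {k : ℕ} (p : Fin k → ℝ) (a : ℝ) (ω : Env k) : ℕ → State k
  | 0 => { pos := p, rings := fun _ => 0, removed := ∅ }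
  | n + 1 =>
    match nextWorker ω.2 (stateAfter p a ω n).rings with
    | some w => ring (dust a ω.1) (stateAfter p a ω n) w
    | none => stateAfter p a ω n

/-- The event that the dust particle at the origin is never removed. -/
def originSurvives {k : ℕ} (p : Fin k → ℝ) (a : ℝ) : Set (Env k) :=
  {ω | ∀ n, 0 ∉ (stateAfter p a ω n).removed}

/-- The probability that the dust particle at the origin is never removed, for `k` workers
initially at the locations `p`, and dust at the origin and at the points of a rate-one Poisson
process on `(a, ∞)`. -/
noncomputable def survivalProb {k : ℕ} (p : Fin k → ℝ) (a : ℝ) : ℝ :=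
  (envLaw k).real (originSurvives p a)

end GreedyCleaning

/-!
Write `l = -log x`, and call a worker's distance from the origin its scale. As long as the origin
survives, a worker at scale `y` always jumps to a scale below `2 * y`: otherwise the origin would be
the closer particle. So each of the `k` workers needs a particle of its own in every doubling of
the scale, from `x` up to order one; there are `l / log 2` doublings, and the presence of `k`
particles between the scales `2 ^ j * x` and `2 ^ (j + 1) * x` costs a factor of about
`(2 ^ j * x) ^ k`. The product of these costs is `exp (-k * l ^ 2 / (2 * log 2) + O(l))`.

*Upper bound.* Almost surely no clock stops and the dust tends to infinity, so on survival every
worker leaves every bounded region, and crosses each level `y` by a jump into `(y, 2 * y)`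
(`exists_crossing`). The particles used by different workers on the levels `2 ^ j * y` are
different, hence at least `k * J` of them lie below `2 ^ J * y` (`dust_mul_lt`). In particular the
gap number `i` is at most `2 ^ (i / k + 1) * y`, and since the gaps are independent with densities
at most one, the survival probability is at most the product of these bounds
(`survivalProb_le_prod`). Working with gaps avoids the counting process of the dust altogether.

*Lower bound.* If no dust lies among the workers at the start, the removed particles are always the
first ones in order, and the origin survives as soon as, for consecutive rings of one clock at the
steps `m < n`, the particle `n + 1` is within twice the distance of the particle `m + 1`
(`originSurvives_of_lt`). Fix `r < 2`. For a number `R = O(l)` of rounds, every clock rings once per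
round, and the round number `j` finds `k` particles just above the scale `r ^ j * y₀`. This is
enforced by windows for the individual gaps and waiting times; the windows for the waiting times
have width `1 / (2 * R)`, so that the clocks stay in step, and this costs only `exp (-O(l * log l))`.
After these rounds the scale is a large constant, and the origin survives if from then on the gaps
and the waiting times obey the law of large numbers with a small relative error, which has a
positive probability independent of `x` (`exists_sumsNearMean_pos`,
`originSurvives_of_regular`). The resulting rate is `k / (2 * log r)`, and `r` tends to `2`.
-/

namespace GreedyCleaning

open MeasureTheory ProbabilityTheory

/-! ### The order of the rings -/

section Clocks

variable {k : ℕ}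

lemma ringTime_mono {wait : Fin k × ℕ → ℝ} (hw : ∀ i, 0 ≤ wait i) (w : Fin k) :
    Monotone (ringTime wait w) := by
  refine monotone_nat_of_le_succ fun n => ?_
  rw [ringTime, ringTime, Finset.sum_range_succ _ (n + 1)]
  linarith [hw (w, n + 1)]

lemma exists_nextWorker (hk : 1 ≤ k) (wait : Fin k × ℕ → ℝ) (r : Fin k → ℕ) :
    ∃ w, nextWorker wait r = some w := by
  rw [← Option.ne_none_iff_exists']
  intro h
  rw [nextWorker, List.argmin_eq_none, List.finRange_eq_nil_iff] at h
  omega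

lemma ringTime_nextWorker_le {wait : Fin k × ℕ → ℝ} {r : Fin k → ℕ} {w : Fin k}
    (h : nextWorker wait r = some w) (v : Fin k) :
    ringTime wait w (r w) ≤ ringTime wait v (r v) :=
  List.le_of_mem_argmin (f := fun w => ringTime wait w (r w)) (List.mem_finRange v) h

variable {p : Fin k → ℝ} {a : ℝ} {ω : Env k} {n : ℕ} {w : Fin k}

/-- `w` is the worker that rings at step `n`, and this is the ring number `j` of its clock
(both counted from `0`). -/
def RingsAt (p : Fin k → ℝ) (a : ℝ) (ω : Env k) (n : ℕ) (w : Fin k) (j : ℕ) : Prop :=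
  nextWorker ω.2 (stateAfter p a ω n).rings = some w ∧ (stateAfter p a ω n).rings w = j

lemma stateAfter_succ (h : nextWorker ω.2 (stateAfter p a ω n).rings = some w) :
    stateAfter p a ω (n + 1) = ring (dust a ω.1) (stateAfter p a ω n) w := by
  simp only [stateAfter, h]

lemma rings_ring (d : ℕ → ℝ) (s : State k) (w : Fin k) :
    (ring d s w).rings = Function.update s.rings w (s.rings w + 1) := by
  unfold ring
  split <;> rfl

lemma rings_succ (h : nextWorker ω.2 (stateAfter p a ω n).rings = some w) :
    (stateAfter p a ω (n + 1)).rings = Function.update (stateAfter p a ω n).rings w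
      ((stateAfter p a ω n).rings w + 1) := by
  rw [stateAfter_succ h, rings_ring]

lemma sum_rings (hk : 1 ≤ k) (p : Fin k → ℝ) (a : ℝ) (ω : Env k) (n : ℕ) :
    ∑ w, (stateAfter p a ω n).rings w = n := by
  induction n with
  | zero => simp [stateAfter]
  | succ n ih =>
    obtain ⟨w, h⟩ := exists_nextWorker hk ω.2 (stateAfter p a ω n).rings
    rw [rings_succ h, Finset.sum_update_of_mem (Finset.mem_univ w)]
    rw [← Finset.add_sum_erase _ _ (Finset.mem_univ w), Finset.erase_eq] at ih
    omega

/-- The last ring of any clock precedes the next ring of any other. -/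
lemma ringTime_last_le (hk : 1 ≤ k) (hw : ∀ i, 0 ≤ ω.2 i) (n : ℕ) :
    ∀ (v w : Fin k) (m : ℕ), (stateAfter p a ω n).rings v = m + 1 →
      ringTime ω.2 v m ≤ ringTime ω.2 w ((stateAfter p a ω n).rings w) := by
  induction n with
  | zero => intro v w m h; simp [stateAfter] at h
  | succ n ih =>
    intro v w m hm
    obtain ⟨u, h⟩ := exists_nextWorker hk ω.2 (stateAfter p a ω n).rings
    rw [rings_succ h] at hm ⊢
    have hle : ringTime ω.2 w ((stateAfter p a ω n).rings w) ≤ ringTime ω.2 w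
        (Function.update (stateAfter p a ω n).rings u ((stateAfter p a ω n).rings u + 1) w) := by
      refine ringTime_mono hw w ?_
      by_cases hwu : w = u
      · subst hwu; simp
      · simp [hwu]
    refine le_trans ?_ hle
    by_cases hvu : v = u
    · subst hvu
      rw [Function.update_self] at hm
      obtain rfl : (stateAfter p a ω n).rings v = m := by omega
      exact ringTime_nextWorker_le h w
    · rw [Function.update_of_ne hvu] at hm
      exact ih v w m hm

/-- If the ring times of each clock tend to infinity, then every ring of every clock is reached after
finitely many steps. -/
lemma exists_le_rings (hk : 1 ≤ k) (hw : ∀ i, 0 ≤ ω.2 i)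
    (hT : ∀ w, Filter.Tendsto (ringTime ω.2 w) Filter.atTop Filter.atTop)
    (w : Fin k) (B : ℕ) : ∃ n, B ≤ (stateAfter p a ω n).rings w := by
  by_contra! hB
  have hM : ∀ v, ∃ M : ℕ, ∀ m, M ≤ m → ringTime ω.2 w B < ringTime ω.2 v m := fun v =>
    Filter.eventually_atTop.1 ((hT v).eventually_gt_atTop _)
  choose M hM using hM
  have hle : ∀ n v, (stateAfter p a ω n).rings v ≤ M v := by
    intro n v
    by_contra! hlt
    obtain ⟨m, hm⟩ : ∃ m, (stateAfter p a ω n).rings v = m + 1 :=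
      ⟨(stateAfter p a ω n).rings v - 1, by omega⟩
    have h1 := ringTime_last_le hk hw n v w m hm
    have h2 := ringTime_mono hw w (hB n).le
    have h3 := hM v m (by omega)
    linarith
  have h := sum_rings hk p a ω (∑ v, M v + 1)
  have h' := Finset.sum_le_sum fun v (_ : v ∈ Finset.univ) => hle (∑ v, M v + 1) v
  omega

end Clocks

/-! ### Jumps to the closest particle -/

section Jumps

variable {k : ℕ}

lemma isClosest_of_closest {d : ℕ → ℝ} {s : Finset ℕ} {y : ℝ} {i : ℕ}
    (h : closest d s y = some i) : IsClosest d s y i ∧ ∀ j < i, ¬ IsClosest d s y j := by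
  classical
  unfold closest at h
  split_ifs at h with hex
  obtain rfl := Option.some.inj h
  exact ⟨Nat.find_spec hex, fun j hj => Nat.find_min hex hj⟩

lemma closest_eq_some {d : ℕ → ℝ} {s : Finset ℕ} {y : ℝ} {i : ℕ}
    (h : IsClosest d s y i) (hlt : ∀ j < i, ¬ IsClosest d s y j) : closest d s y = some i := by
  classical
  unfold closest
  rw [dif_pos ⟨i, h⟩]
  exact congrArg some ((Nat.find_eq_iff _).2 ⟨h, hlt⟩)

lemma exists_closest {d : ℕ → ℝ} (hd : Filter.Tendsto d Filter.atTop Filter.atTop)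
    {s : Finset ℕ} (h0 : 0 ∉ s) (y : ℝ) : ∃ i, closest d s y = some i := by
  classical
  obtain ⟨N, hN⟩ := Filter.eventually_atTop.1 (hd.eventually_gt_atTop (y + |d 0 - y|))
  have hex : ∃ i, IsClosest d s y i := by
    obtain ⟨i, hi, hmin⟩ := Finset.exists_min_image
      ((Finset.range (N + 1)).filter (· ∉ s)) (fun i => |d i - y|) ⟨0, by simp [h0]⟩
    simp only [Finset.mem_filter, Finset.mem_range] at hi hmin
    refine ⟨i, hi.2, fun j hj => ?_⟩
    by_cases hjN : j < N + 1
    · exact hmin j ⟨hjN, hj⟩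
    · have h1 := hN j (by omega)
      have h2 := hmin 0 ⟨by omega, h0⟩
      have h3 := le_abs_self (d j - y)
      linarith
  exact ⟨_, dif_pos hex⟩

lemma ring_of_closest {d : ℕ → ℝ} {s : State k} {w : Fin k} {i : ℕ}
    (h : closest d s.removed (s.pos w) = some i) :
    ring d s w = { pos := Function.update s.pos w (d i)
                   rings := Function.update s.rings w (s.rings w + 1)
                   removed := insert i s.removed } := by
  simp only [ring, h]

/-- As long as the particle `0` at the origin remains, a worker jumps to less than twice its
distance from the origin. -/
lemma lt_two_mul_of_closest {d : ℕ → ℝ} {s : Finset ℕ} {y : ℝ} {i : ℕ} (hd : d 0 = 0)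
    (h0 : 0 ∉ s) (hi : i ≠ 0) (hy : 0 ≤ y) (h : closest d s y = some i) : d i < 2 * y := by
  obtain ⟨⟨-, hmin⟩, hlt⟩ := isClosest_of_closest h
  -- In the case of equality the smaller label `0` would have been chosen.
  have hne : |d i - y| < |d 0 - y| := by
    refine lt_of_le_of_ne (hmin 0 h0) fun he => hlt 0 (Nat.pos_of_ne_zero hi) ⟨h0, ?_⟩
    exact fun j hj => he ▸ hmin j hj
  rw [hd, zero_sub, abs_neg, abs_of_nonneg hy] at hne
  linarith [le_abs_self (d i - y)]

lemma dust_zero (a : ℝ) (g : ℕ → ℝ) : dust a g 0 = 0 := rfl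

lemma dust_succ (a : ℝ) (g : ℕ → ℝ) (n : ℕ) :
    dust a g (n + 1) = a + ∑ i ∈ Finset.range (n + 1), g i := rfl

lemma dust_mono {a : ℝ} (ha : 0 ≤ a) {g : ℕ → ℝ} (hg : ∀ i, 0 ≤ g i) : Monotone (dust a g) := by
  refine monotone_nat_of_le_succ fun n => ?_
  cases n with
  | zero => simp only [dust_zero, dust_succ]; simpa using add_nonneg ha (hg 0)
  | succ n =>
    rw [dust_succ, dust_succ, Finset.sum_range_succ _ (n + 1)]
    linarith [hg (n + 1)]

end Jumps

/-! ### Survival of the origin forces `k` particles per doubling of the scale -/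

section Necessary

variable {k : ℕ} {p : Fin k → ℝ} {a : ℝ} {ω : Env k}

/-- While the origin survives and the particles tend to infinity, every ring is a jump. -/
lemma exists_jump (hd : Filter.Tendsto (dust a ω.1) Filter.atTop Filter.atTop)
    (hω : ω ∈ originSurvives p a) {n : ℕ} {w : Fin k}
    (h : nextWorker ω.2 (stateAfter p a ω n).rings = some w) :
    ∃ i, i ≠ 0 ∧ i ∉ (stateAfter p a ω n).removed ∧
      closest (dust a ω.1) (stateAfter p a ω n).removed ((stateAfter p a ω n).pos w) = some i ∧
      (stateAfter p a ω (n + 1)).pos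
        = Function.update (stateAfter p a ω n).pos w (dust a ω.1 i) ∧
      (stateAfter p a ω (n + 1)).removed = insert i (stateAfter p a ω n).removed := by
  obtain ⟨i, hi⟩ := exists_closest hd (hω n) ((stateAfter p a ω n).pos w)
  have hs := stateAfter_succ h
  rw [ring_of_closest hi] at hs
  refine ⟨i, ?_, (isClosest_of_closest hi).1.1, hi, by rw [hs], by rw [hs]⟩
  rintro rfl
  refine hω (n + 1) ?_
  rw [hs]
  simp

lemma removed_mono (hk : 1 ≤ k) (hd : Filter.Tendsto (dust a ω.1) Filter.atTop Filter.atTop)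
    (hω : ω ∈ originSurvives p a) : Monotone fun n => (stateAfter p a ω n).removed := by
  refine monotone_nat_of_le_succ fun n => ?_
  obtain ⟨u, h⟩ := exists_nextWorker hk ω.2 (stateAfter p a ω n).rings
  obtain ⟨i, -, -, -, -, hr⟩ := exists_jump hd hω h
  simp only [hr]
  exact Finset.subset_insert _ _

lemma pos_nonneg (hk : 1 ≤ k) (hp : ∀ w, 0 ≤ p w) (ha : 0 ≤ a) (hg : ∀ i, 0 ≤ ω.1 i)
    (hd : Filter.Tendsto (dust a ω.1) Filter.atTop Filter.atTop)
    (hω : ω ∈ originSurvives p a) (n : ℕ) : ∀ w, 0 ≤ (stateAfter p a ω n).pos w := by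
  induction n with
  | zero => exact hp
  | succ n ih =>
    intro w
    obtain ⟨u, h⟩ := exists_nextWorker hk ω.2 (stateAfter p a ω n).rings
    obtain ⟨i, -, -, -, hpos, -⟩ := exists_jump hd hω h
    rw [hpos]
    by_cases hwu : w = u
    · subst hwu
      rw [Function.update_self]
      exact dust_mono ha hg (Nat.zero_le i)
    · rw [Function.update_of_ne hwu]
      exact ih w

/-- No worker stays in a bounded region, since each of its jumps uses up a new particle. -/
lemma exists_lt_pos (hk : 1 ≤ k) (hw : ∀ i, 0 ≤ ω.2 i)
    (hT : ∀ w, Filter.Tendsto (ringTime ω.2 w) Filter.atTop Filter.atTop)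
    (hd : Filter.Tendsto (dust a ω.1) Filter.atTop Filter.atTop)
    (hω : ω ∈ originSurvives p a) (w : Fin k) (y : ℝ) :
    ∃ n, y < (stateAfter p a ω n).pos w := by
  by_contra! hy
  obtain ⟨N, hN⟩ := Filter.eventually_atTop.1 (hd.eventually_gt_atTop y)
  have key : ∀ n, (stateAfter p a ω n).rings w
      ≤ ((stateAfter p a ω n).removed ∩ Finset.range N).card := by
    intro n
    induction n with
    | zero => simp [stateAfter]
    | succ n ih =>
      obtain ⟨u, h⟩ := exists_nextWorker hk ω.2 (stateAfter p a ω n).rings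
      obtain ⟨i, -, hi, -, hpos, hrem⟩ := exists_jump hd hω h
      rw [rings_succ h, hrem]
      by_cases hwu : w = u
      · subst hwu
        have h1 := hy (n + 1)
        rw [hpos, Function.update_self] at h1
        have hiN : i < N := by
          by_contra! hNi
          linarith [hN i hNi]
        rw [Function.update_self, Finset.insert_inter_of_mem (Finset.mem_range.2 hiN),
          Finset.card_insert_of_notMem (by simp [hi])]
        omega
      · rw [Function.update_of_ne hwu]
        exact ih.trans (Finset.card_le_card
          (Finset.inter_subset_inter_right (Finset.subset_insert _ _)))
  obtain ⟨n, hn⟩ := exists_le_rings (p := p) (a := a) hk hw hT w (N + 1)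
  have h1 := key n
  have h2 := Finset.card_le_card (Finset.inter_subset_right (s₁ := (stateAfter p a ω n).removed)
    (s₂ := Finset.range N))
  rw [Finset.card_range] at h2
  omega

/-- Each worker crosses the level `y` by a jump to a particle in `(y, 2y)`. -/
lemma exists_crossing (hk : 1 ≤ k) (hp : ∀ w, 0 ≤ p w) (ha : 0 ≤ a) (hg : ∀ i, 0 ≤ ω.1 i)
    (hw : ∀ i, 0 ≤ ω.2 i)
    (hT : ∀ w, Filter.Tendsto (ringTime ω.2 w) Filter.atTop Filter.atTop)
    (hd : Filter.Tendsto (dust a ω.1) Filter.atTop Filter.atTop)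
    (hω : ω ∈ originSurvives p a) (w : Fin k) {y : ℝ} (hy : p w ≤ y) :
    ∃ n i, nextWorker ω.2 (stateAfter p a ω n).rings = some w ∧ i ≠ 0 ∧
      i ∉ (stateAfter p a ω n).removed ∧ i ∈ (stateAfter p a ω (n + 1)).removed ∧
      y < dust a ω.1 i ∧ dust a ω.1 i < 2 * y := by
  classical
  have hex := exists_lt_pos hk hw hT hd hω w y
  set N := Nat.find hex with hNdef
  have hN : y < (stateAfter p a ω N).pos w := Nat.find_spec hex
  have hN0 : N ≠ 0 := by
    intro h0
    rw [h0] at hN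
    exact absurd hN (not_lt.2 hy)
  obtain ⟨n, hn⟩ := Nat.exists_eq_succ_of_ne_zero hN0
  have hlt : (stateAfter p a ω n).pos w ≤ y := not_lt.1 (Nat.find_min hex (by omega))
  rw [hn, Nat.succ_eq_add_one] at hN
  obtain ⟨u, h⟩ := exists_nextWorker hk ω.2 (stateAfter p a ω n).rings
  obtain ⟨i, hi0, hi, hcl, hpos, hrem⟩ := exists_jump hd hω h
  have hwu : w = u := by
    by_contra hne
    rw [hpos, Function.update_of_ne hne] at hN
    linarith
  subst hwu
  rw [hpos, Function.update_self] at hN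
  have h2 := lt_two_mul_of_closest (dust_zero a ω.1) (hω n) hi0
    (pos_nonneg hk hp ha hg hd hω n w) hcl
  exact ⟨n, i, h, hi0, hi, by rw [hrem]; exact Finset.mem_insert_self _ _, hN, by linarith⟩

/-- If the origin survives, then `k` different particles are removed from each of the intervals
`(2^j y, 2^(j+1) y)` with `j < J`, where all workers start in `[0, y]`. -/
lemma dust_mul_lt (hk : 1 ≤ k) (ha : 0 ≤ a) (hg : ∀ i, 0 ≤ ω.1 i)
    (hw : ∀ i, 0 ≤ ω.2 i)
    (hT : ∀ w, Filter.Tendsto (ringTime ω.2 w) Filter.atTop Filter.atTop)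
    (hd : Filter.Tendsto (dust a ω.1) Filter.atTop Filter.atTop)
    (hω : ω ∈ originSurvives p a) {y : ℝ} (hy : 0 < y) (hp : ∀ w, 0 ≤ p w)
    (hpy : ∀ w, p w ≤ y) (J : ℕ) : dust a ω.1 (k * J) < 2 ^ J * y := by
  have hcross : ∀ q : Fin k × Fin J, ∃ n i, nextWorker ω.2 (stateAfter p a ω n).rings = some q.1 ∧
      i ≠ 0 ∧ i ∉ (stateAfter p a ω n).removed ∧ i ∈ (stateAfter p a ω (n + 1)).removed ∧
      2 ^ (q.2 : ℕ) * y < dust a ω.1 i ∧ dust a ω.1 i < 2 * (2 ^ (q.2 : ℕ) * y) := by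
    intro q
    refine exists_crossing hk hp ha hg hw hT hd hω q.1 ((hpy q.1).trans ?_)
    exact le_mul_of_one_le_left hy.le (one_le_pow₀ one_le_two)
  choose n i hn hi0 hi hi' hlo hhi using hcross
  have hdm := dust_mono ha hg
  have hrm := removed_mono hk hd hω
  have hlevel : ∀ q q' : Fin k × Fin J, i q = i q' → (q.2 : ℕ) ≤ q'.2 := by
    intro q q' he
    by_contra! hlt
    have h1 : (2 : ℝ) ^ ((q'.2 : ℕ) + 1) ≤ 2 ^ (q.2 : ℕ) := pow_le_pow_right₀ one_le_two hlt
    have h2 := hlo q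
    have h3 := hhi q'
    rw [he] at h2
    rw [pow_succ] at h1
    nlinarith
  have hstep : ∀ q q' : Fin k × Fin J, i q = i q' → n q ≤ n q' := by
    intro q q' he
    by_contra! hlt
    exact hi q (he ▸ hrm hlt (hi' q'))
  have hinj : Function.Injective i := by
    intro q q' he
    have h1 := le_antisymm (hstep q q' he) (hstep q' q he.symm)
    have h2 := hn q
    rw [h1, hn q'] at h2
    exact Prod.ext (Option.some.inj h2).symm
      (Fin.ext (le_antisymm (hlevel q q' he) (hlevel q' q he.symm)))
  by_contra! hge
  have hmem : ∀ q ∈ (Finset.univ : Finset (Fin k × Fin J)), i q ∈ Finset.Ico 1 (k * J) := by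
    intro q _
    rw [Finset.mem_Ico]
    refine ⟨Nat.one_le_iff_ne_zero.2 (hi0 q), ?_⟩
    by_contra! hle
    have h1 := hdm hle
    have h2 := hhi q
    have h3 : (2 : ℝ) ^ ((q.2 : ℕ) + 1) ≤ 2 ^ J := pow_le_pow_right₀ one_le_two q.2.2
    rw [pow_succ] at h3
    nlinarith
  have hcard := Finset.card_le_card_of_injOn i hmem hinj.injOn
  simp only [Finset.card_univ, Fintype.card_prod, Fintype.card_fin, Nat.card_Ico] at hcard
  rcases Nat.eq_zero_or_pos (k * J) with h0 | h0
  · rw [h0, dust_zero] at hge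
    have : 0 < 2 ^ J * y := by positivity
    linarith
  · omega

lemma gap_le_of_originSurvives (hk : 1 ≤ k) (ha : 0 ≤ a) (hg : ∀ i, 0 ≤ ω.1 i)
    (hw : ∀ i, 0 ≤ ω.2 i)
    (hT : ∀ w, Filter.Tendsto (ringTime ω.2 w) Filter.atTop Filter.atTop)
    (hd : Filter.Tendsto (dust a ω.1) Filter.atTop Filter.atTop)
    (hω : ω ∈ originSurvives p a) {y : ℝ} (hy : 0 < y) (hp : ∀ w, 0 ≤ p w)
    (hpy : ∀ w, p w ≤ y) (i : ℕ) : ω.1 i ≤ 2 ^ (i / k + 1) * y := by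
  have h1 := dust_mul_lt hk ha hg hw hT hd hω hy hp hpy (i / k + 1)
  have h2 : dust a ω.1 (i + 1) ≤ dust a ω.1 (k * (i / k + 1)) :=
    dust_mono ha hg (Nat.lt_mul_div_succ i hk)
  rw [dust_succ] at h2
  have h3 := Finset.single_le_sum (f := ω.1) (fun j _ => hg j)
    (Finset.mem_range.2 (Nat.lt_succ_self i))
  linarith

end Necessary

/-! ### A condition that makes the origin survive -/

section Sufficient

variable {k : ℕ} {p : Fin k → ℝ} {a : ℝ} {ω : Env k}

/-- If the workers start in the region free of dust, then the removed particles are always the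
first ones; so the origin survives as soon as the next particle is always within twice the distance
from the origin of the worker whose turn it is. -/
lemma originSurvives_of_lt (hk : 1 ≤ k) (ha : 0 ≤ a) (hg : ∀ i, 0 ≤ ω.1 i)
    (hp : ∀ w, p w ≤ dust a ω.1 1)
    (hfirst : ∀ n w, RingsAt p a ω n w 0 → dust a ω.1 (n + 1) < 2 * p w)
    (hnext : ∀ m n w j, RingsAt p a ω m w j → RingsAt p a ω n w (j + 1) →
      dust a ω.1 (n + 1) < 2 * dust a ω.1 (m + 1)) :
    ω ∈ originSurvives p a := by
  have hdm := dust_mono ha hg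
  -- The labels removed so far, and the history behind the present position of each worker.
  have key : ∀ n, (stateAfter p a ω n).removed = Finset.Icc 1 n ∧ ∀ w,
      ((stateAfter p a ω n).rings w = 0 ∧ (stateAfter p a ω n).pos w = p w) ∨
      ∃ m j, m < n ∧ RingsAt p a ω m w j ∧ (stateAfter p a ω n).rings w = j + 1 ∧
        (stateAfter p a ω n).pos w = dust a ω.1 (m + 1) := by
    intro n
    induction n with
    | zero => exact ⟨by simp [stateAfter], fun w => Or.inl ⟨rfl, rfl⟩⟩
    | succ n ih =>
      obtain ⟨hrem, hpos⟩ := ih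
      obtain ⟨u, h⟩ := exists_nextWorker hk ω.2 (stateAfter p a ω n).rings
      have hle : (stateAfter p a ω n).pos u ≤ dust a ω.1 (n + 1) := by
        rcases hpos u with ⟨-, h2⟩ | ⟨m, j, hmn, -, -, h2⟩
        · rw [h2]; exact (hp u).trans (hdm (by omega))
        · rw [h2]; exact hdm (by omega)
      have hlt : dust a ω.1 (n + 1) < 2 * (stateAfter p a ω n).pos u := by
        rcases hpos u with ⟨h1, h2⟩ | ⟨m, j, hmn, hr, h1, h2⟩
        · rw [h2]; exact hfirst n u ⟨h, h1⟩
        · rw [h2]; exact hnext m n u j hr ⟨h, h1⟩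
      have hcl : closest (dust a ω.1) (stateAfter p a ω n).removed ((stateAfter p a ω n).pos u)
          = some (n + 1) := by
        have habs : |dust a ω.1 (n + 1) - (stateAfter p a ω n).pos u|
            = dust a ω.1 (n + 1) - (stateAfter p a ω n).pos u := abs_of_nonneg (by linarith)
        have hzero : |dust a ω.1 (n + 1) - (stateAfter p a ω n).pos u|
            < |dust a ω.1 0 - (stateAfter p a ω n).pos u| := by
          rw [habs, dust_zero, zero_sub, abs_neg]
          linarith [le_abs_self ((stateAfter p a ω n).pos u)]
        refine closest_eq_some ⟨by simp [hrem], fun j hj => ?_⟩ fun j hj hclo => ?_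
        · rw [hrem, Finset.mem_Icc] at hj
          rcases Nat.eq_zero_or_pos j with rfl | hj0
          · exact hzero.le
          · have := hdm (show n + 1 ≤ j by omega)
            rw [habs]
            linarith [le_abs_self (dust a ω.1 j - (stateAfter p a ω n).pos u)]
        · have h1 := hclo.1
          rw [hrem, Finset.mem_Icc] at h1
          obtain rfl : j = 0 := by omega
          exact absurd (hclo.2 (n + 1) (by simp [hrem])) (not_le.2 hzero)
      have hs := stateAfter_succ h
      rw [ring_of_closest hcl] at hs
      refine ⟨?_, fun w => ?_⟩
      · rw [hs]
        ext i
        simp only [hrem, Finset.mem_insert, Finset.mem_Icc]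
        omega
      · by_cases hwu : w = u
        · subst hwu
          exact Or.inr ⟨n, _, Nat.lt_succ_self n, ⟨h, rfl⟩, by rw [hs]; simp, by rw [hs]; simp⟩
        · rw [hs]
          simp only [Function.update_of_ne hwu]
          rcases hpos w with h1 | ⟨m, j, hmn, h1⟩
          · exact Or.inl h1
          · exact Or.inr ⟨m, j, by omega, h1⟩
  intro n
  rw [(key n).1]
  simp

end Sufficient

/-! ### The exponential law and its infinite products -/

section Exponential

local instance : IsProbabilityMeasure (expMeasure 1) := isProbabilityMeasure_expMeasure one_pos

lemma expMeasure_real_Iic {t : ℝ} (ht : 0 ≤ t) :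
    (expMeasure 1).real (Set.Iic t) = 1 - Real.exp (-t) := by
  rw [← cdf_eq_real, cdf_expMeasure_eq one_pos, if_pos ht, one_mul]

lemma expMeasure_real_Iic_le {t : ℝ} (ht : 0 ≤ t) : (expMeasure 1).real (Set.Iic t) ≤ t := by
  rw [expMeasure_real_Iic ht]
  linarith [Real.add_one_le_exp (-t)]

lemma le_expMeasure_real_Icc {A h : ℝ} (hA : 0 ≤ A) (hh : 0 ≤ h) :
    h * Real.exp (-(A + h)) ≤ (expMeasure 1).real (Set.Icc A (A + h)) := by
  have h1 : (expMeasure 1).real (Set.Iic (A + h)) - (expMeasure 1).real (Set.Iic A)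
      ≤ (expMeasure 1).real (Set.Icc A (A + h)) := by
    rw [← measureReal_sdiff (Set.Iic_subset_Iic.2 (by linarith)) measurableSet_Iic]
    refine measureReal_mono fun z hz => ?_
    simp only [Set.mem_sdiff, Set.mem_Iic, not_le] at hz
    exact ⟨hz.2.le, hz.1⟩
  rw [expMeasure_real_Iic hA, expMeasure_real_Iic (by linarith)] at h1
  have h2 : Real.exp (-A) = Real.exp (-(A + h)) * Real.exp h := by
    rw [← Real.exp_add]; ring_nf
  nlinarith [Real.add_one_le_exp h, Real.exp_pos (-(A + h))]

lemma ae_expMeasure_pos : ∀ᵐ t ∂(expMeasure 1), 0 < t := by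
  have h := expMeasure_real_Iic le_rfl
  rw [neg_zero, Real.exp_zero, sub_self, measureReal_eq_zero_iff] at h
  rw [ae_iff]
  simpa [Set.Iic] using h

lemma expMeasure_one_eq :
    expMeasure 1 = (volume.restrict (Set.Ioi 0)).withDensity
      fun t => ((Real.exp (-t)).toNNReal : ENNReal) := by
  rw [expMeasure, gammaMeasure, ← withDensity_indicator measurableSet_Ioi]
  refine withDensity_congr_ae ?_
  have h0 : ∀ᵐ t : ℝ, t ≠ 0 := by simp [ae_iff]
  filter_upwards [h0] with t ht
  change exponentialPDF 1 t = _
  rw [exponentialPDF_eq]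
  rcases lt_or_gt_of_ne ht with h | h
  · rw [if_neg (not_le.2 h), Set.indicator_of_notMem (by simpa using h.le), ENNReal.ofReal_zero]
  · rw [if_pos h.le, Set.indicator_of_mem (by simpa using h), one_mul, one_mul, ENNReal.ofReal]

lemma exp_mul_rpow_one : (fun t : ℝ => Real.exp (-t) * t ^ ((2 : ℝ) - 1))
    = fun t : ℝ => ((Real.exp (-t)).toNNReal) • t := by
  funext t
  rw [NNReal.smul_def, Real.coe_toNNReal _ (Real.exp_pos _).le, smul_eq_mul]
  norm_num

lemma integrable_id_expMeasure : Integrable (fun t : ℝ => t) (expMeasure 1) := by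
  rw [expMeasure_one_eq, integrable_withDensity_iff_integrable_smul (by fun_prop),
    ← exp_mul_rpow_one]
  exact Real.GammaIntegral_convergent two_pos

lemma integral_id_expMeasure : ∫ t : ℝ, t ∂(expMeasure 1) = 1 := by
  rw [expMeasure_one_eq, integral_withDensity_eq_integral_smul (by fun_prop),
    ← exp_mul_rpow_one, ← Real.Gamma_eq_integral two_pos, Real.Gamma_two]

variable {ι κ : Type*}

lemma ae_infinitePi_pos [Countable ι] :
    ∀ᵐ g ∂(Measure.infinitePi fun _ : ι => expMeasure 1), ∀ i, 0 < g i := by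
  rw [ae_all_iff]
  exact fun i => (measurePreserving_eval_infinitePi (fun _ : ι => expMeasure 1) i
    ).quasiMeasurePreserving.ae ae_expMeasure_pos

/-- The strong law of large numbers along a sequence of distinct coordinates. -/
lemma ae_tendsto_average {e : ℕ → ι} (he : Function.Injective e) :
    ∀ᵐ g ∂(Measure.infinitePi fun _ : ι => expMeasure 1),
      Filter.Tendsto (fun n : ℕ => (∑ i ∈ Finset.range n, g (e i)) / (n : ℝ)) Filter.atTop
        (nhds (1 : ℝ)) := by
  have hmp := fun i : ι => measurePreserving_eval_infinitePi (fun _ : ι => expMeasure 1) i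
  have hint : ∀ i : ι, ∫ g, g i ∂(Measure.infinitePi fun _ : ι => expMeasure 1) = 1 := by
    intro i
    have h := integral_map (μ := Measure.infinitePi fun _ : ι => expMeasure 1)
      (f := fun t : ℝ => t) (hmp i).measurable.aemeasurable
      aestronglyMeasurable_id
    rw [(hmp i).map_eq, integral_id_expMeasure] at h
    exact h.symm
  have hlaw := strong_law_ae_real (μ := Measure.infinitePi fun _ : ι => expMeasure 1)
    (fun n g => g (e n)) ?_ ?_ ?_
  · simpa only [hint] using hlaw
  · exact (hmp (e 0)).integrable_comp_of_integrable integrable_id_expMeasure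
  · intro m n hmn
    exact (iIndepFun_infinitePi (P := fun _ : ι => expMeasure 1) (X := fun _ t => t)
      (fun _ => measurable_id)).indepFun (he.ne hmn)
  · intro n
    exact ⟨(hmp _).measurable.aemeasurable, (hmp _).measurable.aemeasurable,
      (hmp (e n)).map_eq.trans (hmp (e 0)).map_eq.symm⟩

lemma tendsto_atTop_of_average {u : ℕ → ℝ}
    (h : Filter.Tendsto (fun n : ℕ => u n / n) Filter.atTop (nhds (1 : ℝ))) :
    Filter.Tendsto u Filter.atTop Filter.atTop := by
  have h1 := h.pos_mul_atTop one_pos (tendsto_natCast_atTop_atTop (R := ℝ))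
  refine h1.congr' ?_
  filter_upwards [Filter.eventually_gt_atTop 0] with n hn
  have : (n : ℝ) ≠ 0 := by positivity
  field_simp

lemma exists_abs_sub_le_of_average {u : ℕ → ℝ}
    (h : Filter.Tendsto (fun n : ℕ => u n / n) Filter.atTop (nhds (1 : ℝ))) {ε : ℝ} (hε : 0 < ε) :
    ∃ M : ℕ, ∀ n : ℕ, |u n - n| ≤ ε * n + M := by
  obtain ⟨N, hN⟩ := Metric.tendsto_atTop.1 h ε hε
  obtain ⟨M, hM⟩ := exists_nat_ge (∑ n ∈ Finset.range (N + 1), |u n - n|)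
  refine ⟨M, fun n => ?_⟩
  have hεn : 0 ≤ ε * n := by positivity
  by_cases hn : n < N + 1
  · have : |u n - n| ≤ ∑ n ∈ Finset.range (N + 1), |u n - n| :=
      Finset.single_le_sum (f := fun n : ℕ => |u n - n|) (fun _ _ => abs_nonneg _)
        (Finset.mem_range.2 hn)
    linarith
  · have hn0 : (0 : ℝ) < n := by
      have : 0 < n := by omega
      exact_mod_cast this
    have h1 := hN n (by omega)
    rw [Real.dist_eq] at h1
    have h2 : u n - n = (u n / n - 1) * n := by field_simp
    rw [h2, abs_mul, abs_of_pos hn0]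
    have h3 : (0 : ℝ) ≤ M := Nat.cast_nonneg M
    nlinarith

/-- The partial sums along the sequences `e c` of coordinates stay close to their means, within a
relative error `ε` and an absolute error `M`. -/
def sumsNearMean (e : κ → ℕ → ι) (ε : ℝ) (M : ℕ) : Set (ι → ℝ) :=
  {g | ∀ c (n : ℕ), |∑ i ∈ Finset.range n, g (e c i) - n| ≤ ε * n + M}

lemma measurableSet_sumsNearMean [Countable κ] (e : κ → ℕ → ι) (ε : ℝ) (M : ℕ) :
    MeasurableSet (sumsNearMean e ε M) := by
  simp only [sumsNearMean, Set.ofPred_forall]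
  refine MeasurableSet.iInter fun c => MeasurableSet.iInter fun n => ?_
  refine measurableSet_le ?_ measurable_const
  fun_prop

lemma exists_sumsNearMean_pos [Fintype κ] {e : κ → ℕ → ι} (he : ∀ c, Function.Injective (e c))
    {ε : ℝ} (hε : 0 < ε) :
    ∃ M : ℕ, ∀ M', M ≤ M' →
      0 < (Measure.infinitePi fun _ : ι => expMeasure 1).real (sumsNearMean e ε M') := by
  have hmono : Monotone (sumsNearMean e ε) := by
    intro M M' hM g hg c n
    have : (M : ℝ) ≤ M' := by exact_mod_cast hM
    exact (hg c n).trans (by linarith)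
  have hae : ∀ᵐ g ∂(Measure.infinitePi fun _ : ι => expMeasure 1),
      g ∈ ⋃ M, sumsNearMean e ε M := by
    have h := ae_all_iff.2 fun c => ae_tendsto_average (ι := ι) (he c)
    filter_upwards [h] with g hg
    choose M hM using fun c => exists_abs_sub_le_of_average (hg c) hε
    refine Set.mem_iUnion.2 ⟨∑ c, M c, fun c n => (hM c n).trans ?_⟩
    have : M c ≤ ∑ c, M c := Finset.single_le_sum (fun _ _ => Nat.zero_le _) (Finset.mem_univ c)
    have : (M c : ℝ) ≤ (∑ c, M c : ℕ) := by exact_mod_cast this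
    linarith
  have hpos : (Measure.infinitePi fun _ : ι => expMeasure 1) (⋃ M, sumsNearMean e ε M) ≠ 0 := by
    rw [(prob_compl_eq_zero_iff (MeasurableSet.iUnion
      fun M => measurableSet_sumsNearMean e ε M)).1 hae]
    exact one_ne_zero
  obtain ⟨M, hM⟩ := exists_measure_pos_of_not_measure_iUnion_null hpos
  exact ⟨M, fun M' hM' => ENNReal.toReal_pos (hM.trans_le (measure_mono (hmono hM'))).ne'
    (measure_ne_top _ _)⟩

/-- Finitely many coordinates are independent of any family of other coordinates. -/
lemma infinitePi_real_inter (F : Finset ι) {s : ι → Set ℝ} (hs : ∀ i, MeasurableSet (s i))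
    {e : κ → ι} (he : Function.Injective e) (hF : ∀ c, e c ∉ F) {G : Set (κ → ℝ)}
    (hG : MeasurableSet G) :
    (Measure.infinitePi fun _ : ι => expMeasure 1).real
      ({g | ∀ i ∈ F, g i ∈ s i} ∩ {g | (fun c => g (e c)) ∈ G})
      = (∏ i ∈ F, (expMeasure 1).real (s i))
        * (Measure.infinitePi fun _ : κ => expMeasure 1).real G := by
  set μ := Measure.infinitePi fun _ : ι => expMeasure 1
  have hind : iIndep (fun i : ι => MeasurableSpace.comap (fun g : ι → ℝ => g i) inferInstance) μ :=
    iIndepFun_infinitePi (P := fun _ : ι => expMeasure 1) (X := fun _ t => t)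
      (fun _ => measurable_id)
  have hdis : Disjoint (F : Set ι) (Set.range e) := by
    rw [Set.disjoint_left]
    rintro _ hi ⟨c, rfl⟩
    exact hF c hi
  have hI := indep_iSup_of_disjoint (fun i => (measurable_pi_apply i).comap_le) hind hdis
  have hle : ∀ (S : Set ι), ∀ i ∈ S,
      MeasurableSpace.comap (fun g : ι → ℝ => g i) inferInstance ≤
      ⨆ i ∈ S, MeasurableSpace.comap (fun g : ι → ℝ => g i) inferInstance := fun S i hi =>
    le_iSup₂ (f := fun i (_ : i ∈ S) =>
      MeasurableSpace.comap (fun g : ι → ℝ => g i) inferInstance) i hi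
  have hA : MeasurableSet[⨆ i ∈ (F : Set ι),
      MeasurableSpace.comap (fun g : ι → ℝ => g i) inferInstance] {g | ∀ i ∈ F, g i ∈ s i} := by
    have : {g : ι → ℝ | ∀ i ∈ F, g i ∈ s i} = ⋂ i ∈ F, (fun g => g i) ⁻¹' s i := by
      ext g; simp
    rw [this]
    refine Finset.measurableSet_biInter _ fun i hi => ?_
    exact hle _ i hi _ ⟨s i, hs i, rfl⟩
  have hB : MeasurableSet[⨆ i ∈ Set.range e,
      MeasurableSpace.comap (fun g : ι → ℝ => g i) inferInstance] {g | (fun c => g (e c)) ∈ G} := by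
    have : Measurable[⨆ i ∈ Set.range e,
        MeasurableSpace.comap (fun g : ι → ℝ => g i) inferInstance] fun g c => g (e c) := by
      refine @measurable_pi_lambda _ _ _ (_) _ _ fun c => ?_
      exact Measurable.mono (comap_measurable (fun g : ι → ℝ => g (e c))) (hle _ _ ⟨c, rfl⟩) le_rfl
    exact this hG
  have h := (Indep_iff _ _ μ).1 hI _ _ hA hB
  rw [measureReal_def, h, ENNReal.toReal_mul]
  congr 1
  · have := Measure.infinitePi_pi (μ := fun _ : ι => expMeasure 1) (s := F) (t := s)
      (fun i _ => hs i)
    simp only [measureReal_def]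
    rw [← ENNReal.toReal_prod, ← this]
    rfl
  · rw [measureReal_def, ← Measure.map_infinitePi_infinitePi_of_inj (P := fun _ : ι => expMeasure 1)
      he, Measure.map_apply (by fun_prop) hG]
    rfl

end Exponential

/-! ### The upper bound for the survival probability -/

section Upper

local instance : IsProbabilityMeasure (expMeasure 1) := isProbabilityMeasure_expMeasure one_pos

variable {k : ℕ} {p : Fin k → ℝ} {a : ℝ}

instance (k : ℕ) : IsProbabilityMeasure (envLaw k) := by
  unfold envLaw
  infer_instance

lemma ae_gap_pos (k : ℕ) : ∀ᵐ ω ∂(envLaw k), ∀ i, 0 < ω.1 i :=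
  Measure.quasiMeasurePreserving_fst.ae ae_infinitePi_pos

lemma ae_wait_pos (k : ℕ) : ∀ᵐ ω ∂(envLaw k), ∀ i, 0 < ω.2 i :=
  Measure.quasiMeasurePreserving_snd.ae ae_infinitePi_pos

lemma ae_tendsto_dust (k : ℕ) (a : ℝ) :
    ∀ᵐ ω ∂(envLaw k), Filter.Tendsto (dust a ω.1) Filter.atTop Filter.atTop := by
  filter_upwards [Measure.quasiMeasurePreserving_fst.ae
    (ae_tendsto_average (Function.injective_id (α := ℕ)))] with ω hω
  rw [← Filter.tendsto_add_atTop_iff_nat 1]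
  exact Filter.tendsto_atTop_add_const_left _ a
    ((Filter.tendsto_add_atTop_iff_nat 1).2 (tendsto_atTop_of_average hω))

lemma ae_tendsto_ringTime (k : ℕ) :
    ∀ᵐ ω ∂(envLaw k), ∀ w, Filter.Tendsto (ringTime ω.2 w) Filter.atTop Filter.atTop := by
  rw [ae_all_iff]
  intro w
  filter_upwards [Measure.quasiMeasurePreserving_snd.ae
    (ae_tendsto_average (Prod.mk_right_injective w (β := ℕ)))] with ω hω
  exact (Filter.tendsto_add_atTop_iff_nat 1).2 (tendsto_atTop_of_average hω)

lemma survivalProb_le_prod (hk : 1 ≤ k) (ha : 0 ≤ a) {y : ℝ} (hy : 0 < y) (hp : ∀ w, 0 ≤ p w)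
    (hpy : ∀ w, p w ≤ y) (J : ℕ) :
    survivalProb p a ≤ ∏ i ∈ Finset.range (k * J), (2 ^ (i / k + 1) * y) := by
  set s : ℕ → Set ℝ := fun i => Set.Iic (2 ^ (i / k + 1) * y) with hs
  have hle : envLaw k (originSurvives p a)
      ≤ envLaw k (Prod.fst ⁻¹' (Set.pi (Finset.range (k * J)) s)) := by
    refine measure_mono_ae ?_
    filter_upwards [ae_gap_pos k, ae_wait_pos k, ae_tendsto_dust k a, ae_tendsto_ringTime k]
      with ω hg hw hd hT hω i _
    exact gap_le_of_originSurvives hk ha (fun i => (hg i).le) (fun i => (hw i).le) hT hd hω hy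
      hp hpy i
  have hmeas : MeasurableSet (Set.pi (Finset.range (k * J) : Set ℕ) s) :=
    MeasurableSet.pi (Finset.countable_toSet _) fun _ _ => measurableSet_Iic
  rw [envLaw, (measurePreserving_fst (μ := Measure.infinitePi fun _ : ℕ => expMeasure 1)
      (ν := Measure.infinitePi fun _ : Fin k × ℕ => expMeasure 1)).measure_preimage
      hmeas.nullMeasurableSet, Measure.infinitePi_pi _ fun _ _ => measurableSet_Iic] at hle
  have hle' := ENNReal.toReal_mono (by
    exact ENNReal.prod_ne_top fun _ _ => measure_ne_top _ _) hle
  rw [ENNReal.toReal_prod] at hle'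
  refine hle'.trans (Finset.prod_le_prod (fun _ _ => ENNReal.toReal_nonneg) fun i _ => ?_)
  exact expMeasure_real_Iic_le (by positivity)

lemma sum_range_mul_div (hk : 1 ≤ k) (f : ℕ → ℝ) (J : ℕ) :
    ∑ i ∈ Finset.range (k * J), f (i / k) = k * ∑ j ∈ Finset.range J, f j := by
  induction J with
  | zero => simp
  | succ J ih =>
    rw [Nat.mul_succ, Finset.sum_range_add, ih, Finset.sum_range_succ, mul_add]
    congr 1
    rw [Finset.sum_congr rfl (g := fun _ => f J), Finset.sum_const, Finset.card_range,
      nsmul_eq_mul]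
    intro i hi
    rw [Nat.mul_add_div hk, Nat.div_eq_of_lt (Finset.mem_range.1 hi), add_zero]

lemma sum_range_natCast (J : ℕ) : ∑ j ∈ Finset.range J, (j : ℝ) = J * (J - 1) / 2 := by
  induction J with
  | zero => simp
  | succ J ih => rw [Finset.sum_range_succ, ih]; push_cast; ring

/-- The bound of `survivalProb_le_prod`, with the number `J` of doublings chosen so that
`2 ^ J * x` is of order one. -/
lemma log_survivalProb_le (hk : 1 ≤ k) {x : ℝ} (hx : 0 < x) (hx1 : x ≤ 1) (ha : 0 ≤ a)
    (hp : ∀ w, 0 ≤ p w) (hpx : ∀ w, p w ≤ 2 * x) (hP : 0 < survivalProb p a) :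
    Real.log (survivalProb p a)
      ≤ -(k : ℝ) / (2 * Real.log 2) * Real.log x ^ 2 + k * (Real.log 2 - 3 / 2 * Real.log x) := by
  have hc : 0 < Real.log 2 := Real.log_pos one_lt_two
  set c := Real.log 2 with hcdef
  set l := -Real.log x with hl
  have hl0 : 0 ≤ l := by rw [hl]; linarith [Real.log_nonpos hx.le hx1]
  have hlx : Real.log x = -l := by rw [hl, neg_neg]
  set J := ⌊l / c⌋₊ with hJ
  have hJ1 : (J : ℝ) * c ≤ l := by
    rw [← le_div_iff₀ hc]; exact Nat.floor_le (by positivity)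
  have hJ2 : l < (J + 1) * c := by
    rw [← div_lt_iff₀ hc]; exact Nat.lt_floor_add_one _
  have h := Real.log_le_log hP
    (survivalProb_le_prod hk ha (show 0 < 2 * x by linarith) hp hpx J)
  rw [Real.log_prod fun i _ => by positivity] at h
  have hlog : ∀ i : ℕ, Real.log (2 ^ (i / k + 1) * (2 * x))
      = (fun j : ℕ => (j : ℝ) * c + (2 * c - l)) (i / k) := by
    intro i
    rw [Real.log_mul (by positivity) (by positivity), Real.log_mul two_ne_zero hx.ne',
      Real.log_pow, hlx]
    push_cast
    ring
  rw [Finset.sum_congr rfl fun i _ => hlog i,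
    sum_range_mul_div hk (fun j : ℕ => (j : ℝ) * c + (2 * c - l)), Finset.sum_add_distrib,
    ← Finset.sum_mul, sum_range_natCast, Finset.sum_const, Finset.card_range, nsmul_eq_mul] at h
  refine h.trans ?_
  have hk0 : (0 : ℝ) ≤ k := Nat.cast_nonneg k
  have hsq : c * J ^ 2 / 2 - J * l ≤ c / 2 - l ^ 2 / (2 * c) := by
    have h1 : (l - J * c) ^ 2 ≤ c ^ 2 := by
      apply pow_le_pow_left₀ <;> linarith
    have h2 : c / 2 - l ^ 2 / (2 * c) - (c * J ^ 2 / 2 - J * l)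
        = (c ^ 2 - (l - J * c) ^ 2) / (2 * c) := by field_simp; ring
    have h3 : 0 ≤ (c ^ 2 - (l - J * c) ^ 2) / (2 * c) := div_nonneg (by linarith) (by linarith)
    linarith
  have hfin : (J : ℝ) * (J - 1) / 2 * c + J * (2 * c - l)
      ≤ -(l ^ 2 / (2 * c)) + (c + 3 / 2 * l) := by linarith
  calc (k : ℝ) * ((J : ℝ) * (J - 1) / 2 * c + J * (2 * c - l))
      ≤ k * (-(l ^ 2 / (2 * c)) + (c + 3 / 2 * l)) := mul_le_mul_of_nonneg_left hfin hk0
    _ = _ := by rw [hlx]; ring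

end Upper

/-! ### Clocks ringing in rounds -/

section Rounds

variable {k : ℕ} {p : Fin k → ℝ} {a : ℝ} {ω : Env k}

/-- The sum of the first `n` waiting times of the clock of `w`. -/
noncomputable def waitSum (wait : Fin k × ℕ → ℝ) (w : Fin k) (n : ℕ) : ℝ :=
  ∑ i ∈ Finset.range n, wait (w, i)

lemma waitSum_mono {wait : Fin k × ℕ → ℝ} (hw : ∀ i, 0 ≤ wait i) (w : Fin k) :
    Monotone (waitSum wait w) := by
  refine monotone_nat_of_le_succ fun n => ?_
  rw [waitSum, waitSum, Finset.sum_range_succ]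
  linarith [hw (w, n)]

/-- When a clock rings, the present time lies between the last and the next ring of every clock. -/
lemma RingsAt.exists_rings (hk : 1 ≤ k) (hw : ∀ i, 0 ≤ ω.2 i) {n j : ℕ} {w : Fin k}
    (h : RingsAt p a ω n w j) :
    ∃ ρ : Fin k → ℕ, ∑ v, ρ v = n ∧ ρ w = j ∧
      ∀ v, waitSum ω.2 v (ρ v) ≤ waitSum ω.2 w (j + 1) ∧
        waitSum ω.2 w (j + 1) ≤ waitSum ω.2 v (ρ v + 1) := by
  refine ⟨(stateAfter p a ω n).rings, sum_rings hk p a ω n, h.2, fun v => ⟨?_, ?_⟩⟩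
  · rcases hv : (stateAfter p a ω n).rings v with _ | m
    · rw [waitSum, Finset.sum_range_zero]
      exact Finset.sum_nonneg fun i _ => hw _
    · have := ringTime_last_le hk hw n v w m hv
      rwa [h.2] at this
  · have := ringTime_nextWorker_le h.1 v
    rwa [h.2] at this

/-- For the first `R` rounds the clocks ring about once per unit of time, within `1/2`; afterwards
they may be late or early, within a relative error `1/20` and an absolute error `M`. (The relative
error only has to be small enough to leave room below the factor `2` in
`originSurvives_of_regular`.) -/
structure RegularClocks (wait : Fin k × ℕ → ℝ) (R M : ℕ) : Prop where
  nonneg : ∀ i, 0 ≤ wait i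
  head : ∀ w n, n ≤ R → (n : ℝ) ≤ waitSum wait w n ∧ waitSum wait w n ≤ n + 1 / 2
  tail : ∀ w i, |waitSum wait w (R + i) - waitSum wait w R - i| ≤ 1 / 20 * i + M

variable {R M : ℕ}

/-- In the first rounds, no ring comes before all the rings of the preceding rounds. -/
lemma RegularClocks.mul_min_le (hk : 1 ≤ k) (hR : 1 ≤ R) (hC : RegularClocks ω.2 R M)
    {n j : ℕ} {w : Fin k} (h : RingsAt p a ω n w j) : k * min j (R - 1) ≤ n := by
  obtain ⟨ρ, hsum, -, hρ⟩ := h.exists_rings hk hC.nonneg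
  have hle : ∀ v ∈ (Finset.univ : Finset (Fin k)), min j (R - 1) ≤ ρ v := by
    intro v _
    by_contra! hlt
    have h1 := (hρ v).2
    have h2 := (hC.head v (ρ v + 1) (by omega)).2
    have h3 := (hC.head w (min j (R - 1) + 1) (by omega)).1
    have h4 := waitSum_mono hC.nonneg w (show min j (R - 1) + 1 ≤ j + 1 by omega)
    have h5 : ((ρ v : ℝ)) + 1 ≤ (min j (R - 1) : ℕ) := by exact_mod_cast hlt
    push_cast at h2 h3 h5
    linarith
  have := Finset.card_nsmul_le_sum _ _ _ hle
  rw [hsum, Finset.card_univ, Fintype.card_fin, smul_eq_mul] at this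
  exact this

/-- In the first rounds, no ring comes after a ring of the following round. -/
lemma RegularClocks.lt_mul (hk : 1 ≤ k) (hC : RegularClocks ω.2 R M)
    {n j : ℕ} {w : Fin k} (hj : j + 2 ≤ R) (h : RingsAt p a ω n w j) : n < k * (j + 1) := by
  obtain ⟨ρ, hsum, hw, hρ⟩ := h.exists_rings hk hC.nonneg
  have hle : ∀ v ∈ (Finset.univ : Finset (Fin k)), ρ v ≤ j + 1 := by
    intro v _
    by_contra! hlt
    have h1 := (hρ v).1
    have h2 := (hC.head w (j + 1) (by omega)).2
    have h3 := (hC.head v (j + 2) (by omega)).1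
    have h4 := waitSum_mono hC.nonneg v (show j + 2 ≤ ρ v by omega)
    push_cast at h2 h3
    linarith
  have := Finset.sum_lt_sum hle ⟨w, Finset.mem_univ w, by omega⟩
  rw [hsum, Finset.sum_const, Finset.card_univ, Fintype.card_fin, smul_eq_mul] at this
  exact this

lemma RegularClocks.waitSum_bounds (hC : RegularClocks ω.2 R M) (w : Fin k) (i : ℕ) :
    R + 19 / 20 * i - M ≤ waitSum ω.2 w (R + i) ∧
      waitSum ω.2 w (R + i) ≤ R + 21 / 20 * i + (M + 1 / 2) := by
  have h1 := hC.head w R le_rfl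
  have h2 := abs_le.1 (hC.tail w i)
  constructor <;> linarith [h1.1, h1.2, h2.1, h2.2]

/-- The number of rings before the ring number `R + u - 1` of a clock, from above. -/
lemma RegularClocks.le_of_late (hk : 1 ≤ k) (hC : RegularClocks ω.2 R M)
    {n j u : ℕ} {w : Fin k} (hj : j + 1 = R + u) (h : RingsAt p a ω n w j) :
    (n : ℝ) ≤ k * R + k * (6 / 5 * u + 4 * (M + 1)) := by
  obtain ⟨ρ, hsum, -, hρ⟩ := h.exists_rings hk hC.nonneg
  have hM : (0 : ℝ) ≤ M := Nat.cast_nonneg M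
  have hu : (0 : ℝ) ≤ u := Nat.cast_nonneg u
  have hle : ∀ v ∈ (Finset.univ : Finset (Fin k)), (ρ v : ℝ) ≤ R + (6 / 5 * u + 4 * (M + 1)) := by
    intro v _
    rcases le_total (ρ v) R with hlt | hge
    · have : (ρ v : ℝ) ≤ R := by exact_mod_cast hlt
      linarith
    · obtain ⟨i, hi⟩ := Nat.exists_eq_add_of_le hge
      have h1 := (hρ v).1
      have h2 := (hC.waitSum_bounds w u).2
      have h3 := (hC.waitSum_bounds v i).1
      rw [hi, hj] at h1
      rw [hi]
      push_cast
      linarith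
  have := Finset.sum_le_sum hle
  rw [← Nat.cast_sum, hsum, Finset.sum_const, Finset.card_univ, Fintype.card_fin,
    nsmul_eq_mul] at this
  linarith

/-- The number of rings before the ring number `R + u - 1` of a clock, from below. -/
lemma RegularClocks.ge_of_late (hk : 1 ≤ k) (hC : RegularClocks ω.2 R M)
    {n j u : ℕ} {w : Fin k} (hj : j + 1 = R + u) (h : RingsAt p a ω n w j) :
    k * R + k * (9 / 10 * u - 2 * (M + 1) - 1) ≤ (n : ℝ) := by
  obtain ⟨ρ, hsum, -, hρ⟩ := h.exists_rings hk hC.nonneg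
  have hM : (0 : ℝ) ≤ M := Nat.cast_nonneg M
  have hu : (0 : ℝ) ≤ u := Nat.cast_nonneg u
  have hle : ∀ v ∈ (Finset.univ : Finset (Fin k)),
      R + (9 / 10 * u - 2 * (M + 1) - 1) ≤ (ρ v : ℝ) := by
    intro v _
    have h1 := (hρ v).2
    have h2 := (hC.waitSum_bounds w u).1
    rw [hj] at h1
    rcases le_total (ρ v + 1) R with hlt | hge
    · have h3 := (hC.head v _ hlt).2
      push_cast at h3
      linarith
    · obtain ⟨i, hi⟩ := Nat.exists_eq_add_of_le hge
      have h3 := (hC.waitSum_bounds v i).2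
      have h4 : (ρ v : ℝ) + 1 = R + i := by exact_mod_cast hi
      rw [hi] at h1
      linarith
  have := Finset.sum_le_sum hle
  rw [← Nat.cast_sum, hsum, Finset.sum_const, Finset.card_univ, Fintype.card_fin,
    nsmul_eq_mul] at this
  linarith

end Rounds

/-! ### Dust growing geometrically, then linearly -/

section Blocks

variable {k : ℕ} {p : Fin k → ℝ} {a : ℝ} {ω : Env k}

/-- For `j < R`, the `k` particles with labels from `k * j + 1` to `k * j + k` lie in `[y j, b j]`;
afterwards the particles have about unit density, within a relative error `1/20` and an absolute
error `M`. -/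
structure RegularDust (k : ℕ) (d : ℕ → ℝ) (y b : ℕ → ℝ) (R M : ℕ) : Prop where
  mono : Monotone d
  head : ∀ i, i < k * R → y (i / k) ≤ d (i + 1) ∧ d (i + 1) ≤ b (i / k)
  tail : ∀ i : ℕ, |d (k * R + i) - d (k * R) - i| ≤ 1 / 20 * i + M

variable {y b d : ℕ → ℝ} {R M : ℕ}

lemma RegularDust.le_of_lt_mul (hk : 1 ≤ k) (hD : RegularDust k d y b R M) {n j : ℕ}
    (hj : j < R) (hn : n < k * (j + 1)) : d (n + 1) ≤ b j := by
  have hpos : 1 ≤ k * (j + 1) := Nat.mul_pos hk (Nat.succ_pos j)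
  have h1 := (hD.head (k * (j + 1) - 1) (by
    have := Nat.mul_le_mul_left k (show j + 1 ≤ R from hj)
    omega)).2
  have h2 : (k * (j + 1) - 1) / k = j := by
    refine Nat.div_eq_of_lt_le ?_ ?_
    · rw [Nat.mul_comm, Nat.mul_succ]; omega
    · rw [Nat.mul_comm (j + 1)]; omega
  rw [h2] at h1
  exact (hD.mono (by omega)).trans h1

lemma RegularDust.ge_of_mul_le (hk : 1 ≤ k) (hD : RegularDust k d y b R M) {n j : ℕ}
    (hj : j < R) (hn : k * j ≤ n) : y j ≤ d (n + 1) := by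
  have h1 := (hD.head (k * j) ((Nat.mul_lt_mul_left hk).2 hj)).1
  rw [Nat.mul_div_cancel_left _ hk] at h1
  exact h1.trans (hD.mono (by omega))

lemma RegularDust.le_add_of_le (hk : 1 ≤ k) (hR : 1 ≤ R) (hD : RegularDust k d y b R M) {n : ℕ}
    {t : ℝ} (ht : 0 ≤ t) (hn : (n : ℝ) ≤ k * R + t) :
    d (n + 1) ≤ b (R - 1) + 21 / 20 * (t + 1) + M := by
  have hM : (0 : ℝ) ≤ M := Nat.cast_nonneg M
  have hlast : ∀ n, n < k * R → d (n + 1) ≤ b (R - 1) := fun n hn =>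
    hD.le_of_lt_mul hk (by omega) (by rwa [Nat.sub_add_cancel hR])
  have hpos : 1 ≤ k * R := Nat.mul_pos hk hR
  rcases lt_or_ge n (k * R) with hlt | hge
  · linarith [hlast n hlt]
  · obtain ⟨i, hi⟩ := Nat.exists_eq_add_of_le (show k * R ≤ n + 1 by omega)
    have h1 := (abs_le.1 (hD.tail i)).2
    have h2 := hlast (k * R - 1) (by omega)
    rw [Nat.sub_add_cancel hpos] at h2
    have h3 : (n : ℝ) + 1 = k * R + i := by exact_mod_cast hi
    rw [hi]
    linarith

lemma RegularDust.add_le_of_le (hk : 1 ≤ k) (hR : 1 ≤ R) (hD : RegularDust k d y b R M) {n : ℕ}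
    {t : ℝ} (hn : k * (R - 1) ≤ n) (ht : k * R + t ≤ n) :
    y (R - 1) + 19 / 20 * t - M ≤ d (n + 1) := by
  have hM : (0 : ℝ) ≤ M := Nat.cast_nonneg M
  have hlast : ∀ n, k * (R - 1) ≤ n → y (R - 1) ≤ d (n + 1) := fun n hn =>
    hD.ge_of_mul_le hk (by omega) hn
  rcases le_total t 0 with ht0 | ht0
  · linarith [hlast n hn]
  · have hge : k * R ≤ n := by
      have : (k : ℝ) * R ≤ n := by linarith
      exact_mod_cast this
    have hlt : k * (R - 1) + 1 ≤ k * R := (Nat.mul_lt_mul_left hk).2 (by omega)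
    obtain ⟨i, hi⟩ := Nat.exists_eq_add_of_le (show k * R ≤ n + 1 by omega)
    have h1 := (abs_le.1 (hD.tail i)).1
    have h2 := hlast (k * R - 1) (by omega)
    rw [Nat.sub_add_cancel (by omega)] at h2
    have h3 : (n : ℝ) + 1 = k * R + i := by exact_mod_cast hi
    rw [hi]
    linarith

/-- Regular clocks and dust let the origin survive: between two consecutive rings of a clock, the
workers use up less dust than is contained in one doubling of the scale. The assumption `hlast` makes
the last scale large enough to absorb all the absolute errors of the tails. -/
lemma originSurvives_of_regular (hk : 1 ≤ k) (ha : 0 ≤ a) (hg : ∀ i, 0 ≤ ω.1 i) (hR : 2 ≤ R)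
    (hC : RegularClocks ω.2 R M) (hD : RegularDust k (dust a ω.1) y b R M)
    (hp : ∀ w, p w ≤ y 0) (hpb : ∀ w, b 0 < 2 * p w) (hyb : ∀ j, b (j + 1) < 2 * y j)
    (hy : y (R - 2) ≤ y (R - 1)) (hlast : b (R - 1) + 16 * (k * (M + 1)) < 2 * y (R - 2)) :
    ω ∈ originSurvives p a := by
  have hk' : (1 : ℝ) ≤ k := by exact_mod_cast hk
  have hM : (0 : ℝ) ≤ M := Nat.cast_nonneg M
  have hkM : (M : ℝ) + 1 ≤ k * (M + 1) := le_mul_of_one_le_left (by linarith) hk'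
  have hkM' : (k : ℝ) ≤ k * (M + 1) := le_mul_of_one_le_right (by linarith) (by linarith)
  refine originSurvives_of_lt hk ha hg (fun w => (hp w).trans ?_) (fun n w h => ?_)
    fun m n w j hm hn => ?_
  · exact hD.ge_of_mul_le (n := 0) hk (by omega) (by omega)
  · exact (hD.le_of_lt_mul hk (by omega) (hC.lt_mul hk (by omega) h)).trans_lt (hpb w)
  · have hlow := hC.mul_min_le hk (by omega) hm
    rcases lt_trichotomy (j + 2) R with hj | hj | hj
    · rw [min_eq_left (by omega)] at hlow
      have h1 := hD.ge_of_mul_le hk (by omega) hlow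
      have h2 := hD.le_of_lt_mul hk (by omega) (hC.lt_mul hk (by omega) hn)
      linarith [hyb j]
    -- The passage from the next-to-last round to the last one, whose rings may come late.
    · rw [min_eq_left (by omega)] at hlow
      have h1 := hD.ge_of_mul_le hk (by omega) hlow
      have h2 := hD.le_add_of_le hk (by omega) (t := k * (6 / 5 * (0 : ℕ) + 4 * (M + 1)))
        (by positivity) (hC.le_of_late hk (show j + 1 + 1 = R + 0 by omega) hn)
      rw [show j = R - 2 by omega] at h1
      push_cast at h2
      linarith
    -- In the linear regime the slope of the upper bound, `21/20 * 6/5`, is less than twice the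
    -- slope of the lower bound, `19/20 * 9/10`.
    · obtain ⟨u, hu⟩ := Nat.exists_eq_add_of_le (show R ≤ j + 1 by omega)
      rw [min_eq_right (by omega)] at hlow
      have hku : (0 : ℝ) ≤ k * u := by positivity
      have h1 := hD.add_le_of_le hk (by omega) hlow (hC.ge_of_late hk hu hm)
      have h2 := hD.le_add_of_le hk (by omega) (t := k * (6 / 5 * (u + 1 : ℕ) + 4 * (M + 1)))
        (by positivity) (hC.le_of_late hk (show j + 1 + 1 = R + (u + 1) by omega) hn)
      push_cast at h2
      linarith

end Blocks

/-! ### The lower bound for the survival probability -/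

section Lower

local instance : IsProbabilityMeasure (expMeasure 1) := isProbabilityMeasure_expMeasure one_pos

variable {k : ℕ} {p : Fin k → ℝ} {a : ℝ}

lemma sum_range_pow_le {r : ℝ} (hr : 4 / 3 ≤ r) (n : ℕ) :
    ∑ j ∈ Finset.range (n + 1), r ^ j ≤ 4 * r ^ n := by
  induction n with
  | zero => norm_num
  | succ n ih =>
    rw [Finset.sum_range_succ]
    have h1 : 0 < r ^ n := by positivity
    have h2 : r ^ (n + 1) = r ^ n * r := pow_succ r n
    nlinarith

/-- The least gap before the particle number `i + 1` that puts it at distance at least `y (i / k)`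
when the preceding particle (or the point `a`, for `i = 0`) is as near as allowed. -/
noncomputable def leastGap (k : ℕ) (a : ℝ) (y : ℕ → ℝ) (i : ℕ) : ℝ :=
  y (i / k) - if i = 0 then a else y ((i - 1) / k)

/-- Gaps within `κ * y (i / k)` of their least value produce regular dust: the errors in a block
and in all the blocks below it sum up to at most `4 * k * κ` times the scale of the block. -/
lemma regularDust_of_gaps (hk : 1 ≤ k) {r y₀ κ : ℝ} (hr : 4 / 3 ≤ r) (hy₀ : 0 ≤ y₀) (hκ : 0 ≤ κ)
    (ha : 0 ≤ a) {g : ℕ → ℝ} (hg : ∀ i, 0 ≤ g i) {R M : ℕ} (hR : 1 ≤ R)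
    (hhead : ∀ i < k * R, g i ∈ Set.Icc (leastGap k a (fun j => r ^ j * y₀) i)
      (leastGap k a (fun j => r ^ j * y₀) i + κ * (r ^ (i / k) * y₀)))
    (htail : (fun i => g (k * R + i)) ∈ sumsNearMean (fun _ : Unit => id) (1 / 20) M) :
    RegularDust k (dust a g) (fun j => r ^ j * y₀) (fun j => (1 + 4 * k * κ) * (r ^ j * y₀)) R M := by
  have hsum : ∀ i < k * R, r ^ (i / k) * y₀ ≤ dust a g (i + 1) ∧
      dust a g (i + 1) ≤ r ^ (i / k) * y₀
        + κ * ∑ l ∈ Finset.range (i + 1), r ^ (l / k) * y₀ := by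
    intro i
    induction i with
    | zero =>
      intro h
      have := hhead 0 h
      simp only [leastGap, if_true, Set.mem_Icc] at this
      rw [dust_succ, zero_add, Finset.sum_range_one, Finset.sum_range_one]
      constructor <;> linarith [this.1, this.2]
    | succ i ih =>
      intro h
      have h1 := ih (by omega)
      have h2 := hhead (i + 1) h
      simp only [leastGap, if_neg (Nat.succ_ne_zero i), Nat.add_sub_cancel, Set.mem_Icc] at h2
      rw [dust_succ] at h1
      rw [dust_succ, Finset.sum_range_succ _ (i + 1), Finset.sum_range_succ _ (i + 1)]
      constructor <;> linarith [h1.1, h1.2, h2.1, h2.2]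
  have hgeom : ∀ i, ∑ l ∈ Finset.range (i + 1), r ^ (l / k) * y₀
      ≤ 4 * k * (r ^ (i / k) * y₀) := by
    intro i
    calc ∑ l ∈ Finset.range (i + 1), r ^ (l / k) * y₀
        ≤ ∑ l ∈ Finset.range (k * (i / k + 1)), r ^ (l / k) * y₀ :=
          Finset.sum_le_sum_of_subset_of_nonneg
            (Finset.range_subset_range.2 (Nat.lt_mul_div_succ i hk)) fun _ _ _ => by positivity
      _ = k * ∑ j ∈ Finset.range (i / k + 1), r ^ j * y₀ :=
          sum_range_mul_div hk (fun j => r ^ j * y₀) _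
      _ = k * ((∑ j ∈ Finset.range (i / k + 1), r ^ j) * y₀) := by rw [Finset.sum_mul]
      _ ≤ k * (4 * r ^ (i / k) * y₀) := by
          gcongr
          exact sum_range_pow_le hr _
      _ = _ := by ring
  refine ⟨dust_mono ha hg, fun i hi => ⟨(hsum i hi).1, (hsum i hi).2.trans ?_⟩, fun i => ?_⟩
  · have := mul_le_mul_of_nonneg_left (hgeom i) hκ
    linarith
  · obtain ⟨n, hn⟩ : ∃ n, k * R = n + 1 := ⟨k * R - 1, by
      have := Nat.mul_pos hk hR
      omega⟩
    have h1 := htail () i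
    have h2 : dust a g (k * R + i) - dust a g (k * R)
        = ∑ l ∈ Finset.range i, g (k * R + l) := by
      rw [hn, show n + 1 + i = n + i + 1 by omega, dust_succ, dust_succ,
        show n + i + 1 = n + 1 + i by omega, Finset.sum_range_add]
      ring
    rw [h2]
    exact h1

lemma regularClocks_of_waits {R M : ℕ} (hR : 1 ≤ R) {wait : Fin k × ℕ → ℝ}
    (hw : ∀ i, 0 ≤ wait i)
    (hhead : ∀ w, ∀ i < R, wait (w, i) ∈ Set.Icc (1 : ℝ) (1 + 1 / (2 * R)))
    (htail : (fun q : Fin k × ℕ => wait (q.1, R + q.2)) ∈ sumsNearMean Prod.mk (1 / 20) M) :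
    RegularClocks wait R M := by
  have hR0 : (0 : ℝ) < R := by exact_mod_cast hR
  refine ⟨hw, fun w n hn => ⟨?_, ?_⟩, fun w i => ?_⟩
  · have := Finset.card_nsmul_le_sum (Finset.range n) (fun i => wait (w, i)) 1
      fun i hi => (hhead w i ((Finset.mem_range.1 hi).trans_le hn)).1
    simpa [waitSum] using this
  · have := Finset.sum_le_card_nsmul (Finset.range n) (fun i => wait (w, i)) (1 + 1 / (2 * R))
      fun i hi => (hhead w i ((Finset.mem_range.1 hi).trans_le hn)).2
    rw [Finset.card_range, nsmul_eq_mul] at this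
    refine this.trans ?_
    have h1 : (n : ℝ) ≤ R := by exact_mod_cast hn
    have h2 : (n : ℝ) * (1 / (2 * R)) ≤ 1 / 2 := by
      rw [mul_one_div, div_le_iff₀ (by positivity)]
      linarith
    linarith
  · have h1 : waitSum wait w (R + i) - waitSum wait w R
        = ∑ l ∈ Finset.range i, wait (w, R + l) := by
      rw [waitSum, waitSum, Finset.sum_range_add]
      ring
    rw [h1]
    exact htail w i

/-- The probability of regular clocks and dust, as a product over the waiting times and the gaps
of the first `R` rounds and of a tail event. -/
lemma prod_le_survivalProb (hk : 1 ≤ k) {r y₀ κ x : ℝ} (hr : 4 / 3 ≤ r) (hy₀ : 0 < y₀)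
    (hκ : 0 < κ) (ha : 0 ≤ a) (hay : a ≤ y₀) {R M : ℕ} (hR : 2 ≤ R)
    (hp : ∀ w, p w ≤ y₀) (hpx : ∀ w, x ≤ p w) (hyx : (1 + 4 * k * κ) * y₀ < 2 * x)
    (hrκ : (1 + 4 * k * κ) * r < 2)
    (hlast : 16 * (k * (M + 1)) < (2 - (1 + 4 * k * κ) * r) * (r ^ (R - 2) * y₀)) {B : ℝ}
    (hB : (1 + κ) * (r ^ (R - 1) * y₀) ≤ B) :
    (∏ i ∈ Finset.range (k * R), κ * (r ^ (i / k) * y₀) * Real.exp (-B))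
      * (Measure.infinitePi fun _ : ℕ => expMeasure 1).real
          (sumsNearMean (fun _ : Unit => id) (1 / 20) M)
      * ((1 / (2 * R) * Real.exp (-2)) ^ (k * R)
      * (Measure.infinitePi fun _ : Fin k × ℕ => expMeasure 1).real
          (sumsNearMean Prod.mk (1 / 20) M))
      ≤ survivalProb p a := by
  have hR0 : (2 : ℝ) ≤ R := by exact_mod_cast hR
  have hr1 : 1 ≤ r := by linarith
  set y : ℕ → ℝ := fun j => r ^ j * y₀ with hy
  have hymono : Monotone y := fun i j hij =>
    mul_le_mul_of_nonneg_right (pow_le_pow_right₀ hr1 hij) hy₀.le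
  have hypos : ∀ j, 0 < y j := fun j => by positivity
  have hleast : ∀ i, 0 ≤ leastGap k a y i ∧ leastGap k a y i ≤ y (i / k) := by
    intro i
    unfold leastGap
    split_ifs with hi
    · subst hi
      rw [Nat.zero_div]
      have : y 0 = y₀ := by simp [hy]
      constructor <;> linarith
    · have h1 := hymono (Nat.div_le_div_right (c := k) (Nat.sub_le i 1))
      constructor <;> linarith [hypos ((i - 1) / k)]
  set sg : ℕ → Set ℝ := fun i => Set.Icc (leastGap k a y i) (leastGap k a y i + κ * y (i / k))
    with hsg
  set sw : Fin k × ℕ → Set ℝ := fun _ => Set.Icc (1 : ℝ) (1 + 1 / (2 * R)) with hsw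
  set Eg : Set (ℕ → ℝ) := {g | ∀ i ∈ Finset.range (k * R), g i ∈ sg i} ∩
    {g | (fun i => g (k * R + i)) ∈ sumsNearMean (fun _ : Unit => id) (1 / 20) M} with hEg
  set Ew : Set (Fin k × ℕ → ℝ) :=
    {g | ∀ q ∈ (Finset.univ : Finset (Fin k)) ×ˢ Finset.range R, g q ∈ sw q} ∩
    {g | (fun q : Fin k × ℕ => g (q.1, R + q.2)) ∈ sumsNearMean Prod.mk (1 / 20) M} with hEw
  have hsub : (envLaw k).real (Eg ×ˢ Ew) ≤ survivalProb p a := by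
    refine ENNReal.toReal_mono (measure_ne_top _ _) (measure_mono_ae ?_)
    filter_upwards [ae_gap_pos k, ae_wait_pos k] with ω hg hw hω
    have hD := regularDust_of_gaps (a := a) hk hr hy₀.le hκ.le ha (fun i => (hg i).le)
      (by omega) (fun i hi => hω.1.1 i (Finset.mem_range.2 hi)) hω.1.2
    have hC := regularClocks_of_waits (by omega) (fun i => (hw i).le)
      (fun w i hi => hω.2.1 (w, i) (Finset.mk_mem_product (Finset.mem_univ w)
        (Finset.mem_range.2 hi))) hω.2.2
    refine originSurvives_of_regular hk ha (fun i => (hg i).le) hR hC hD ?_ ?_ ?_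
      (hymono (by omega)) ?_
    · intro w
      simpa using hp w
    · intro w
      simp only [pow_zero, one_mul]
      linarith [hpx w]
    · intro j
      have := mul_lt_mul_of_pos_right hrκ (hypos j)
      calc (1 + 4 * k * κ) * (r ^ (j + 1) * y₀) = (1 + 4 * k * κ) * r * y j := by
            simp only [hy]; ring
        _ < 2 * y j := this
    · have h1 : r ^ (R - 1) = r * r ^ (R - 2) := by
        rw [← pow_succ']
        congr 1
        omega
      rw [h1]
      linarith
  refine le_trans ?_ hsub
  have hprod : (envLaw k).real (Eg ×ˢ Ew)
      = (Measure.infinitePi fun _ : ℕ => expMeasure 1).real Eg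
        * (Measure.infinitePi fun _ : Fin k × ℕ => expMeasure 1).real Ew := by
    rw [envLaw, measureReal_prod_prod]
  have hinjg : Function.Injective fun i : ℕ => k * R + i := add_right_injective _
  have hinjw : Function.Injective fun q : Fin k × ℕ => (q.1, R + q.2) := by
    rintro ⟨v, i⟩ ⟨w, j⟩ h
    simpa using h
  rw [hprod, hEg, hEw,
    infinitePi_real_inter (Finset.range (k * R)) (fun _ => measurableSet_Icc) hinjg (by simp)
      (measurableSet_sumsNearMean _ _ _),
    infinitePi_real_inter (Finset.univ ×ˢ Finset.range R) (fun _ => measurableSet_Icc) hinjw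
      (by simp) (measurableSet_sumsNearMean _ _ _)]
  refine mul_le_mul (mul_le_mul_of_nonneg_right ?_ measureReal_nonneg)
    (mul_le_mul_of_nonneg_right ?_ measureReal_nonneg) (by positivity) (by positivity)
  · refine Finset.prod_le_prod (fun i _ => by positivity) fun i hi => ?_
    have hdiv : i / k ≤ R - 1 := by
      have := (Nat.div_lt_iff_lt_mul hk).2 (Nat.mul_comm k R ▸ Finset.mem_range.1 hi)
      omega
    refine le_trans ?_ (le_expMeasure_real_Icc (hleast i).1
      (mul_nonneg hκ.le (hypos (i / k)).le))
    refine mul_le_mul_of_nonneg_left (Real.exp_le_exp.2 (neg_le_neg ?_))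
      (mul_nonneg hκ.le (hypos (i / k)).le)
    have h1 : (1 + κ) * y (i / k) ≤ (1 + κ) * y (R - 1) :=
      mul_le_mul_of_nonneg_left (hymono hdiv) (by linarith)
    linarith [(hleast i).2]
  · have hone : 1 / (2 * (R : ℝ)) * Real.exp (-2) ≤ (expMeasure 1).real
        (Set.Icc (1 : ℝ) (1 + 1 / (2 * R))) := by
      refine le_trans ?_ (le_expMeasure_real_Icc zero_le_one (by positivity))
      refine mul_le_mul_of_nonneg_left (Real.exp_le_exp.2 (neg_le_neg ?_)) (by positivity)
      have : 1 / (2 * (R : ℝ)) ≤ 1 := by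
        rw [div_le_one (by linarith)]
        linarith
      linarith
    refine (pow_le_pow_left₀ (by positivity) hone _).trans_eq ?_
    rw [Finset.prod_const, Finset.card_product, Finset.card_univ, Fintype.card_fin,
      Finset.card_range]

/-- The logarithm of the bound of `prod_le_survivalProb`. -/
lemma le_log_prod (hk : 1 ≤ k) {r y₀ κ x : ℝ} (hr : 1 < r) (hx : 0 < x) (hxy : x ≤ y₀)
    (hκ : 0 < κ) {R : ℕ} (hR : 1 ≤ R) (B : ℝ) {c₁ c₂ : ℝ} (hc₁ : 0 < c₁) (hc₂ : 0 < c₂) :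
    -(k : ℝ) / (2 * Real.log r) * Real.log x ^ 2
      - k * R * (Real.log r / 2 + B + 2 - Real.log κ + Real.log (2 * R)) + Real.log (c₁ * c₂)
      ≤ Real.log ((∏ i ∈ Finset.range (k * R), κ * (r ^ (i / k) * y₀) * Real.exp (-B)) * c₁
        * ((1 / (2 * R) * Real.exp (-2)) ^ (k * R) * c₂)) := by
  have hR0 : (0 : ℝ) < R := by exact_mod_cast hR
  have hr0 : 0 < r := by linarith
  have hy₀ : 0 < y₀ := by linarith
  have hlr : 0 < Real.log r := Real.log_pos hr
  have hprod : (∏ i ∈ Finset.range (k * R), κ * (r ^ (i / k) * y₀) * Real.exp (-B)) ≠ 0 :=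
    Finset.prod_ne_zero_iff.2 fun i _ => by positivity
  rw [Real.log_mul hc₁.ne' hc₂.ne', Real.log_mul (mul_ne_zero hprod hc₁.ne') (by positivity),
    Real.log_mul hprod hc₁.ne', Real.log_mul (by positivity) hc₂.ne', Real.log_pow,
    Real.log_mul (by positivity) (Real.exp_pos _).ne', Real.log_exp, one_div, Real.log_inv,
    Real.log_prod fun i _ => by positivity]
  have hlog : ∀ i : ℕ, Real.log (κ * (r ^ (i / k) * y₀) * Real.exp (-B))
      = (fun j : ℕ => (j : ℝ) * Real.log r + (Real.log κ + Real.log y₀ - B)) (i / k) := by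
    intro i
    rw [Real.log_mul (by positivity) (Real.exp_pos _).ne', Real.log_exp,
      Real.log_mul hκ.ne' (by positivity), Real.log_mul (by positivity) hy₀.ne', Real.log_pow]
    ring
  rw [Finset.sum_congr rfl fun i _ => hlog i,
    sum_range_mul_div hk (fun j : ℕ => (j : ℝ) * Real.log r + (Real.log κ + Real.log y₀ - B)),
    Finset.sum_add_distrib, ← Finset.sum_mul, sum_range_natCast, Finset.sum_const,
    Finset.card_range, nsmul_eq_mul]
  have hk0 : (0 : ℝ) ≤ k := Nat.cast_nonneg k
  -- Completing the square: the sum is smallest when `R * log r = -log x`.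
  have hsq : -(Real.log x ^ 2 / (2 * Real.log r))
      ≤ R ^ 2 / 2 * Real.log r + R * Real.log x := by
    have h1 : R ^ 2 / 2 * Real.log r + R * Real.log x + Real.log x ^ 2 / (2 * Real.log r)
        = (R * Real.log r + Real.log x) ^ 2 / (2 * Real.log r) := by field_simp; ring
    have h2 : 0 ≤ (R * Real.log r + Real.log x) ^ 2 / (2 * Real.log r) := by positivity
    linarith
  have hmono : R * Real.log x ≤ R * Real.log y₀ :=
    mul_le_mul_of_nonneg_left (Real.log_le_log hx hxy) hR0.le
  have := mul_le_mul_of_nonneg_left (hsq.trans (add_le_add_right hmono _)) hk0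
  push_cast
  have h3 : -(k : ℝ) / (2 * Real.log r) * Real.log x ^ 2
      = k * -(Real.log x ^ 2 / (2 * Real.log r)) := by ring
  rw [h3]
  linarith

end Lower

/-! ### Logarithmic asymptotics -/

section Asymptotics

lemma exists_small_spread {k : ℕ} (hk : 1 ≤ k) {r s : ℝ} (hr0 : 0 < r) (hr : r < 2) (hs : s < 2) :
    ∃ κ : ℝ, 0 < κ ∧ κ ≤ 1 ∧ (1 + 4 * k * κ) * r < 2 ∧ (1 + 4 * k * κ) * s < 2 := by
  have hk0 : (1 : ℝ) ≤ k := by exact_mod_cast hk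
  have hq2 : max r s < 2 := max_lt hr hs
  have hq0 : 0 < max r s := lt_max_of_lt_left hr0
  have h1 : 4 * (k : ℝ) * ((2 - max r s) / (16 * k)) = (2 - max r s) / 4 := by field_simp; ring
  have h2 : (1 + (2 - max r s) / 4) * max r s < 2 := by nlinarith
  have h3 : 0 ≤ 1 + (2 - max r s) / 4 := by linarith
  refine ⟨(2 - max r s) / (16 * k), div_pos (by linarith) (by linarith), ?_, ?_, ?_⟩
  · rw [div_le_one (by linarith)]
    linarith
  · rw [h1]
    exact (mul_le_mul_of_nonneg_left (le_max_left r s) h3).trans_lt h2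
  · rw [h1]
    exact (mul_le_mul_of_nonneg_left (le_max_right r s) h3).trans_lt h2

lemma exists_pow_mul_le_lt {r y L : ℝ} (hr : 1 < r) (hy : 0 < y) (hyL : y ≤ L) :
    ∃ m : ℕ, r ^ m * y ≤ L ∧ L < r ^ (m + 1) * y := by
  obtain ⟨m, h1, h2⟩ := exists_nat_pow_near ((one_le_div hy).2 hyL) hr
  exact ⟨m, (le_div_iff₀ hy).1 h1, (div_lt_iff₀ hy).1 h2⟩

/-- The lower bound with growth factor `r < 2` per round, where the rounds go up to a fixed scale,
from which the origin survives with a probability that does not depend on `x`. The error term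
comes from the prefactors of the `O(-log x)` rounds, and from keeping the clocks in step. -/
lemma exists_le_log_survivalProb {k : ℕ} (hk : 1 ≤ k) {δ r : ℝ} (hδ₀ : 0 < δ) (hδ₁ : δ < 1)
    (hr : 4 / 3 ≤ r) (hr2 : r < 2) :
    ∃ C η : ℝ, 0 < η ∧ ∀ x : ℝ, 0 < x → x < η → ∀ p : Fin k → ℝ, (∀ w, x ≤ p w) →
      (∀ w, p w ≤ (2 - δ) * x) → ∀ a : ℝ, 0 ≤ a → a ≤ (2 - δ) * x →
      0 < survivalProb p a ∧
      -(k : ℝ) / (2 * Real.log r) * Real.log x ^ 2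
        - C * (-Real.log x * (1 + Real.log (-Real.log x))) ≤ Real.log (survivalProb p a) := by
  have hk0 : (1 : ℝ) ≤ k := by exact_mod_cast hk
  have hlr : 0 < Real.log r := Real.log_pos (by linarith)
  obtain ⟨κ, hκ, hκ1, hκr, hκδ⟩ := exists_small_spread hk (r := r) (s := 2 - δ / 2)
    (by linarith) hr2 (by linarith)
  obtain ⟨M₁, hM₁⟩ := exists_sumsNearMean_pos (e := fun _ : Unit => (id : ℕ → ℕ))
    (fun _ => Function.injective_id) (show (0 : ℝ) < 1 / 20 by norm_num)
  obtain ⟨M₂, hM₂⟩ := exists_sumsNearMean_pos (e := fun (w : Fin k) (i : ℕ) => (w, i))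
    (fun w => Prod.mk_right_injective w) (show (0 : ℝ) < 1 / 20 by norm_num)
  set M := max M₁ M₂
  have hc₁ := hM₁ M (le_max_left _ _)
  have hc₂ := hM₂ M (le_max_right _ _)
  set c₁ := (Measure.infinitePi fun _ : ℕ => expMeasure 1).real
    (sumsNearMean (fun _ : Unit => (id : ℕ → ℕ)) (1 / 20) M)
  set c₂ := (Measure.infinitePi fun _ : Fin k × ℕ => expMeasure 1).real
    (sumsNearMean (fun (w : Fin k) (i : ℕ) => (w, i)) (1 / 20) M)
  -- The scale from which the tail events alone guarantee survival.
  set L := 16 * (k * ((M : ℝ) + 1)) / (2 - (1 + 4 * k * κ) * r) with hL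
  have hden : 0 < 2 - (1 + 4 * k * κ) * r := by linarith
  have hL0 : 0 < L := by positivity
  set C₁ := Real.log r / 2 + 8 * L + 2 - Real.log κ with hC₁
  set C₃ := 3 + (|Real.log L| + 1) / Real.log r with hC₃
  have hC₃3 : 3 ≤ C₃ := by
    have : 0 ≤ (|Real.log L| + 1) / Real.log r := by positivity
    linarith
  refine ⟨k * C₃ * (|C₁| + Real.log (2 * C₃) + 1) + |Real.log (c₁ * c₂)|,
    min (L / 2) (Real.exp (-1)), lt_min (by linarith) (Real.exp_pos _), ?_⟩
  intro x hx hxη p hxp hpx a ha hax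
  have hxL : x < L / 2 := hxη.trans_le (min_le_left _ _)
  set l := -Real.log x with hl
  have hl1 : 1 ≤ l := by
    have h1 := Real.log_lt_log hx (hxη.trans_le (min_le_right _ _))
    rw [Real.log_exp] at h1
    linarith
  set y₀ := (2 - δ / 2) * x with hy₀
  have hδx : 0 < δ * x := mul_pos hδ₀ hx
  have hδx1 : δ * x < x := mul_lt_of_lt_one_left hx hδ₁
  have hxy : x ≤ y₀ := by linarith
  have hy₀L : y₀ ≤ L := by linarith
  have hy₀0 : 0 < y₀ := by linarith
  obtain ⟨m, hm1, hm2⟩ := exists_pow_mul_le_lt (show 1 < r by linarith) hy₀0 hy₀L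
  have hB : (1 + κ) * (r ^ (m + 3 - 1) * y₀) ≤ 8 * L := by
    have h1 : r ^ (m + 3 - 1) * y₀ = r ^ 2 * (r ^ m * y₀) := by
      rw [show m + 3 - 1 = 2 + m by omega, pow_add]; ring
    have h2 : r ^ 2 ≤ 4 := by nlinarith
    have h3 : r ^ 2 * (r ^ m * y₀) ≤ 4 * L := by
      apply mul_le_mul h2 hm1 <;> positivity
    rw [h1]
    calc (1 + κ) * (r ^ 2 * (r ^ m * y₀)) ≤ 2 * (4 * L) := by
          apply mul_le_mul _ h3 <;> first | positivity | linarith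
      _ = 8 * L := by ring
  have hlast : 16 * (k * ((M : ℝ) + 1))
      < (2 - (1 + 4 * k * κ) * r) * (r ^ (m + 3 - 2) * y₀) := by
    rw [show m + 3 - 2 = m + 1 by omega]
    rw [hL, div_lt_iff₀ hden] at hm2
    linarith
  have hprod := prod_le_survivalProb (p := p) (a := a) (x := x) (R := m + 3) (M := M) hk hr hy₀0 hκ
    ha (by linarith) (by omega) (fun w => by linarith [hpx w]) hxp
    (by rw [hy₀, ← mul_assoc]; exact mul_lt_mul_of_pos_right hκδ hx) hκr hlast hB
  have hlog := le_log_prod (R := m + 3) hk (show 1 < r by linarith) hx hxy hκ (by omega) (8 * L)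
    hc₁ hc₂
  rw [← hC₁] at hlog
  have hpos : 0 < (∏ i ∈ Finset.range (k * (m + 3)), κ * (r ^ (i / k) * y₀) * Real.exp (-(8 * L)))
      * c₁ * ((1 / (2 * ((m + 3 : ℕ) : ℝ)) * Real.exp (-2)) ^ (k * (m + 3)) * c₂) := by
    have : 0 < r := by linarith
    have : 0 < ∏ i ∈ Finset.range (k * (m + 3)), κ * (r ^ (i / k) * y₀) * Real.exp (-(8 * L)) :=
      Finset.prod_pos fun i _ => by positivity
    positivity
  refine ⟨hpos.trans_le hprod, le_trans ?_ (hlog.trans (Real.log_le_log hpos hprod))⟩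
  -- The number of rounds is at most `C₃ * l`.
  have hRl : ((m + 3 : ℕ) : ℝ) ≤ C₃ * l := by
    have h1 := Real.log_le_log (by positivity) hm1
    rw [Real.log_mul (by positivity) hy₀0.ne', Real.log_pow] at h1
    have h2 := Real.log_le_log hx hxy
    have h3 : (m : ℝ) ≤ (|Real.log L| + l) / Real.log r := by
      rw [le_div_iff₀ hlr]
      linarith [le_abs_self (Real.log L)]
    have h4 : (|Real.log L| + l) / Real.log r ≤ (|Real.log L| + 1) / Real.log r * l := by
      rw [div_mul_eq_mul_div]
      refine div_le_div_of_nonneg_right ?_ hlr.le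
      rw [add_mul, one_mul]
      exact add_le_add_left (le_mul_of_one_le_right (abs_nonneg _) hl1) _
    push_cast
    rw [hC₃, add_mul]
    linarith
  set R : ℝ := ((m + 3 : ℕ) : ℝ) with hR
  have hR0 : 0 < R := by rw [hR]; positivity
  have hll : 0 ≤ Real.log l := Real.log_nonneg hl1
  have hC₃l : 0 ≤ Real.log (2 * C₃) := Real.log_nonneg (by linarith)
  have hlogR : Real.log (2 * R) ≤ Real.log (2 * C₃) + Real.log l := by
    rw [← Real.log_mul (by linarith) (by linarith)]
    exact Real.log_le_log (by linarith) (by linarith)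
  have h1 : C₁ + Real.log (2 * R) ≤ (|C₁| + Real.log (2 * C₃) + 1) * (1 + Real.log l) := by
    have h2 : 0 ≤ (|C₁| + Real.log (2 * C₃)) * Real.log l := by positivity
    linarith [le_abs_self C₁]
  have h2 : k * R * (C₁ + Real.log (2 * R))
      ≤ k * (C₃ * l) * ((|C₁| + Real.log (2 * C₃) + 1) * (1 + Real.log l)) := by
    refine (mul_le_mul_of_nonneg_left h1 (by positivity)).trans ?_
    gcongr
  have h3 : |Real.log (c₁ * c₂)| ≤ |Real.log (c₁ * c₂)| * (l * (1 + Real.log l)) := by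
    exact le_mul_of_one_le_right (abs_nonneg _) (one_le_mul_of_one_le_of_one_le hl1 (by linarith))
  linarith [neg_abs_le (Real.log (c₁ * c₂))]

lemma eventually_mul_one_add_log_lt (C : ℝ) {ε : ℝ} (hε : 0 < ε) :
    ∀ᶠ l : ℝ in Filter.atTop, C * (l * (1 + Real.log l)) < ε * l ^ 2 := by
  have h1 : Filter.Tendsto (fun l : ℝ => C * (1 / l + Real.log l / l)) Filter.atTop
      (nhds (C * (0 + 0))) := by
    refine Filter.Tendsto.const_mul C (Filter.Tendsto.add ?_ ?_)
    · exact tendsto_const_nhds.div_atTop Filter.tendsto_id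
    · exact Real.isLittleO_log_id_atTop.tendsto_div_nhds_zero
  rw [add_zero, mul_zero] at h1
  filter_upwards [h1.eventually_lt_const hε, Filter.eventually_gt_atTop 0] with l hl hl0
  have h2 : C * (l * (1 + Real.log l)) = C * (1 / l + Real.log l / l) * l ^ 2 := by
    field_simp
  rw [h2]
  exact mul_lt_mul_of_pos_right hl (by positivity)

end Asymptotics

end GreedyCleaning

theorem lemma23 (k : ℕ) (hk : 1 ≤ k) (δ : ℝ) (hδ₀ : 0 < δ) (hδ₁ : δ < 1) :
    ∀ ε : ℝ, 0 < ε → ∃ η : ℝ, 0 < η ∧ ∀ x : ℝ, 0 < x → x < η →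
      ∀ p : Fin k → ℝ, Monotone p →
        p ⟨0, by omega⟩ = x → p ⟨k - 1, by omega⟩ ≤ (2 - δ) * x →
      ∀ a : ℝ, x ≤ a → a ≤ p ⟨k - 1, by omega⟩ →
        0 < GreedyCleaning.survivalProb p a ∧
        |Real.log (GreedyCleaning.survivalProb p a) / Real.log x ^ 2
          - (-(k : ℝ) / (2 * Real.log 2))| < ε := by
  intro ε hε
  -- A growth factor `r < 2` per round costs at most `ε / 2` in the rate.
  obtain ⟨r, hr, hr2, hrε⟩ : ∃ r : ℝ, 4 / 3 ≤ r ∧ r < 2 ∧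
      -(k : ℝ) / (2 * Real.log 2) - ε / 2 < -(k : ℝ) / (2 * Real.log r) := by
    have hcont : ContinuousAt (fun r : ℝ => -(k : ℝ) / (2 * Real.log r)) 2 := by
      refine continuousAt_const.div (continuousAt_const.mul (Real.continuousAt_log two_ne_zero)) ?_
      have := Real.log_pos one_lt_two
      positivity
    have hev := (hcont.eventually_const_lt (show -(k : ℝ) / (2 * Real.log 2) - ε / 2
      < -(k : ℝ) / (2 * Real.log 2) by linarith)).filter_mono
      (nhdsWithin_le_nhds (s := Set.Iio 2))
    obtain ⟨r, hr1, hr2, hr3⟩ := (hev.and ((eventually_nhdsWithin_of_forall fun r hr => hr).and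
      (eventually_nhdsWithin_of_eventually_nhds
        (eventually_ge_nhds (show (4 / 3 : ℝ) < 2 by norm_num))))).exists
    exact ⟨r, hr3, hr2, hr1⟩
  obtain ⟨C, η, hη, hlow⟩ :=
    GreedyCleaning.exists_le_log_survivalProb hk hδ₀ hδ₁ hr hr2
  obtain ⟨l₀, hl₀⟩ := Filter.eventually_atTop.1
    ((GreedyCleaning.eventually_mul_one_add_log_lt C (half_pos hε)).and
      ((GreedyCleaning.eventually_mul_one_add_log_lt (k * 3) hε).and
        (Filter.eventually_ge_atTop 1)))
  refine ⟨min η (Real.exp (-l₀)), lt_min hη (Real.exp_pos _), ?_⟩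
  intro x hx hxη p hmono hp0 hplast a hxa hap
  have hxp : ∀ w, x ≤ p w := fun w => hp0 ▸ hmono (Fin.mk_le_of_le_val (Nat.zero_le _))
  have hpx : ∀ w, p w ≤ (2 - δ) * x := fun w =>
    (hmono (Fin.le_def.2 (Nat.le_sub_one_of_lt w.2))).trans hplast
  obtain ⟨hpos, hlower⟩ := hlow x hx (hxη.trans_le (min_le_left _ _)) p hxp hpx a (by linarith)
    (hap.trans hplast)
  refine ⟨hpos, ?_⟩
  have hl : l₀ ≤ -Real.log x := by
    have h := Real.log_lt_log hx (hxη.trans_le (min_le_right _ _))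
    rw [Real.log_exp] at h
    linarith
  obtain ⟨h1, h2, h3⟩ := hl₀ _ hl
  have hδx : 0 < δ * x := mul_pos hδ₀ hx
  have hupper := GreedyCleaning.log_survivalProb_le hk hx
    ((Real.log_nonpos_iff hx.le).1 (by linarith)) (by linarith) (fun w => by linarith [hxp w])
    (fun w => by linarith [hpx w]) hpos
  have hsq : 0 < Real.log x ^ 2 := by
    have : Real.log x ≠ 0 := by linarith
    positivity
  rw [neg_sq] at h1 h2
  have hlog2 : Real.log 2 - 3 / 2 * Real.log x
      ≤ 3 * (-Real.log x * (1 + Real.log (-Real.log x))) := by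
    have h4 : -Real.log x * 1 ≤ -Real.log x * (1 + Real.log (-Real.log x)) :=
      mul_le_mul_of_nonneg_left (by linarith [Real.log_nonneg h3]) (by linarith)
    linarith [Real.log_two_lt_d9]
  have hk0 : (0 : ℝ) ≤ k := Nat.cast_nonneg k
  have h5 := mul_le_mul_of_nonneg_left hlog2 hk0
  have h6 := mul_lt_mul_of_pos_right hrε hsq
  rw [abs_lt, lt_sub_iff_add_lt, sub_lt_iff_lt_add, lt_div_iff₀ hsq, div_lt_iff₀ hsq]
  constructor <;> linarith
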